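/- **Setting.** Let $T>0$, let $(\Omega,\mathcal F,\mathbb P)$ be a probability space with a filtration $(\mathcal F_t)_{t\in[0,T]}$, and let $Z=(Z^1,Z^2)$ be an $\mathbb R^2$-valued additive process: $Z$ is càdlàg, adapted and continuous in probability, $Z_0=0$ a.s., and $Z_t-Z_u$ is independent of $\mathcal F_u$ for $0\le u\le t\le T$ (for example with $(\mathcal F_t)$ the canonical filtration of $Z$). Put $X=e^{Z^1}$, $S=e^{Z^2}$, $\mathcal O=\,]0,\infty[^2$ and $$D=\{z=(z_1,z_2)\in\mathbb C^2:\ \mathbb E[X_T^{\mathrm{Re}\,z_1}S_T^{\mathrm{Re}\,z_2}]<\infty\}.$$ For $z\in D$ let $t\mapsto\kappa_t(z)$ be the continuous function with $\kappa_0(z)=0$ and $e^{\kappa_t(z)}=\mathbb E[X_t^{z_1}S_t^{z_2}]$, and let $\rho^S_t=\kappa_t(0,2)-2\kappa_t(0,1)$. Assume that $(0,2)\in D$ and that $\rho^S$ is strictly increasing on $[0,T]$. **Admissible pairs.** Let $\Pi$ be a finite complex Borel measure on $\mathbb C^2$ and $\lambda:[0,T]\times\mathbb C^2\to\mathbb C$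 a Borel function, and put $I_0=\mathrm{Re}(\mathrm{supp}\,\Pi)\subset\mathbb R^2$. Call $(\Pi,\lambda)$ admissible if 1. $I_0$ is bounded, $I_0\subset D$, and $\sup_{(a,b)\in I_0}\mathbb E[X_T^aS_T^b]<\infty$; 2. for all $z\in\mathrm{supp}\,\Pi$, $\lambda(dt,z)\ll\rho^S_{dt}$ and $\kappa_{dt}(z)\ll\rho^S_{dt}$; 3. $\int_{\mathbb C^2}|\lambda(t,z)|^2\,d|\Pi|(z)<\infty$ for every $t\in[0,T]$; 4. $\int_0^T d\rho^S_t\int_{\mathbb C^2}d|\Pi|(z)\,\Big|\frac{d\lambda(t,z)}{d\rho^S_t}+\lambda(t,z)\frac{d\kappa_t(z)}{d\rho^S_t}\Big|<\infty$. Here the densities are taken jointly Borel in $(t,z)$, $z \in \mathrm{supp}\,\Pi$. For an admissible pair and $t\in[0,T]$, $x,s>0$, set $$f_{\Pi,\lambda}(t,x,s)=\int_{\mathbb C^2}d\Pi(z)\,x^{z_1}s^{z_2}\lambda(t,z),\qquad g_{\Pi,\lambda}(t,x,s)=\int_{\mathbb C^2}d\Pi(z)\,x^{z_1}s^{z_2}\Big\{\frac{d\lambda(t,z)}{d\rho^S_t}+\lambda(t,z)\frac{d\kappa_t(z)}{d\rho^S_t}\Big\},$$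 and let $D(\mathfrak a)$ be the set of all functions $f_{\Pi,\lambda}$ with $(\Pi,\lambda)$ admissible. **Statement.** (i) For every admissible $(\Pi,\lambda)$ the integral defining $f_{\Pi,\lambda}$ converges absolutely for all $(t,x,s)$, and the one defining $g_{\Pi,\lambda}$ for $d\rho^S$-a.e. $t$ and all $x,s>0$; $f_{\Pi,\lambda}$ is continuous on $[0,T]\times\mathcal O$; and $$t\longmapsto f_{\Pi,\lambda}(t,X_t,S_t)-\int_0^t g_{\Pi,\lambda}(u,X_{u-},S_{u-})\,d\rho^S_u$$ is a (true) martingale. (ii) There is an operator $\mathfrak a$ on $D(\mathfrak a)$, well defined up to $d\rho^S$-null sets of times, such that for every admissible $(\Pi,\lambda)$ one has $\mathfrak a(f_{\Pi,\lambda})(t,x,s)=g_{\Pi,\lambda}(t,x,s)$ for $d\rho^S$-a.e. $t$ and all $x,s>0$. (iii) For every such $\mathfrak a$, $(X,S)$ is a solution of the strong martingale problem related to $(D(\mathfrak a),\mathfrak a,\rho^S)$. That is: $\rho^S$ is continuous and nondecreasing; $(X,S)$ is càdlàg and adapted; $D(\mathfrak a)\subset C([0,T]\times\mathcal O,\mathbb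 C)$; for every $f\in D(\mathfrak a)$ and every compact $K\subset\mathcal O$, $\sup_{(x,s)\in K}|\mathfrak a(f)(t,x,s)|<\infty$ for $d\rho^S$-a.e. $t$; and for every $f\in D(\mathfrak a)$, $\int_0^T|\mathfrak a(f)(u,X_{u-},S_{u-})|\,d\rho^S_u<\infty$ a.s., the process $\int_0^\cdot\mathfrak a(f)(u,X_{u-},S_{u-})\,d\rho^S_u$ is adapted and a.s. continuous and of bounded variation, and $f(t,X_t,S_t)-\int_0^t\mathfrak a(f)(u,X_{u-},S_{u-})\,d\rho^S_u$ is a local martingale (so $f(t,X_t,S_t)$ is a semimartingale with continuous bounded variation component). -/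

import Mathlib

open MeasureTheory ProbabilityTheory Filter Set
open scoped Topology ENNReal

noncomputable section

namespace StrongMP

/-! ### Integration on the time interval `[0,T]` -/

/-- The time interval `[0,T]`; all processes are indexed by it. -/
abbrev Time (T : ℝ) : Type := Set.Icc (0 : ℝ) T

variable {T : ℝ}

/-- A path is càdlàg: right-continuous with left limits. -/
def IsCadlag {E : Type*} [TopologicalSpace E] (y : Time T → E) : Prop :=
  ∀ t, ContinuousWithinAt y (Ici t) t ∧ ∃ l, Tendsto y (𝓝[<] t) (𝓝 l)

section
variable [Fact ((0 : ℝ) ≤ T)]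

open Classical in
/-- The Lebesgue–Stieltjes measure `dA` on `[0,T]` of a nondecreasing function `A`
(it does not charge `{0}`). -/
def dMeas (A : Time T → ℝ) : Measure (Time T) :=
  if h : Monotone A then h.stieltjesFunction.measure else 0

/-- `ψ` is a Radon–Nikodym density `dφ/dA`: `φ(t) = φ(0) + ∫_0^t ψ dA` for all `t ∈ [0,T]`. -/
def IsDensity (A : Time T → ℝ) (φ ψ : Time T → ℂ) : Prop :=
  Integrable ψ (dMeas A) ∧ ∀ t, φ t = φ ⊥ + ∫ u in Iic t, ψ u ∂(dMeas A)

/-- `φ(dt) ≪ dA`. -/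
def AbsCont (A : Time T → ℝ) (φ : Time T → ℂ) : Prop := ∃ ψ, IsDensity A φ ψ

open Classical in
/-- For a family `t ↦ φ t z`, `z ∈ G`, of functions that are absolutely continuous with respect
to `A`: a jointly Borel version of the density `(t, z) ↦ dφ(t,z)/dA_t`. For `z ∈ G` it is unique
up to a `dA`-null set of times. -/
def jointDensity (A : Time T → ℝ) (G : Set (ℂ × ℂ)) (φ : Time T → ℂ × ℂ → ℂ) :
    Time T → ℂ × ℂ → ℂ :=
  if h : ∃ ψ : Time T → ℂ × ℂ → ℂ, Measurable (Function.uncurry ψ) ∧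
      ∀ z ∈ G, IsDensity A (fun t => φ t z) (fun t => ψ t z)
  then h.choose else 0

/-! ### The strong martingale problem -/

/-- A local martingale on `[0,T]` (with càdlàg paths). -/
def IsLocalMartingale {Ω : Type*} {mΩ : MeasurableSpace Ω} (F : Filtration (Time T) mΩ)
    (P : Measure Ω) (M : Time T → Ω → ℂ) : Prop :=
  Locally (fun N => Martingale N F P ∧ ∀ᵐ ω ∂P, IsCadlag (fun t => N t ω)) F M P

/-- The space `𝓛`: functions `h : [0,T] × O → ℂ` such that for every compact `K ⊆ O`,
`sup_{y ∈ K} |h(t,y)| < ∞` for `dA`-almost every `t`. -/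
def LocBddSpace (O : Set (ℝ × ℝ)) (A : Time T → ℝ) : Set (Time T → O → ℂ) :=
  {h | ∀ K : Set O, IsCompact K → ∀ᵐ t ∂(dMeas A), BddAbove ((fun y => ‖h t y‖) '' K)}

/-- The drift `t ↦ ∫_0^t h(u, Y_{u-}) dA_u`. -/
def drift {Ω : Type*} {O : Set (ℝ × ℝ)} (A : Time T → ℝ) (Y : Time T → Ω → O)
    (h : Time T → O → ℂ) : Time T → Ω → ℂ :=
  fun t ω => ∫ u in Iic t, h u (Function.leftLim (fun s => Y s ω) u) ∂(dMeas A)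

/-- The `O`-valued càdlàg process `Y = (X,S)` solves the strong martingale problem related to
`(Da, a, A)`, for a deterministic continuous nondecreasing integrator `A`: `a` maps
`Da ⊆ C([0,T] × O, ℂ)` to `𝓛`, and for every `g ∈ Da` the process `g(t, Y_t)` is a semimartingale,
the sum of a local martingale and of the continuous adapted process of bounded variation
`∫_0^t a(g)(u, Y_{u-}) dA_u`, the latter integral being absolutely convergent. -/
structure SolvesStrongMP {Ω : Type*} {mΩ : MeasurableSpace Ω} (F : Filtration (Time T) mΩ)
    (P : Measure Ω) (O : Set (ℝ × ℝ)) (Da : Set (Time T → O → ℂ))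
    (a : (Time T → O → ℂ) → (Time T → O → ℂ)) (A : Time T → ℝ) (Y : Time T → Ω → O) : Prop where
  continuous_integrator : Continuous A
  monotone_integrator : Monotone A
  cadlag : ∀ ω, IsCadlag (fun t => Y t ω)
  adapted : ∀ t, Measurable[F t] (Y t)
  dom_continuous : ∀ g ∈ Da, Continuous (fun p : Time T × O => g p.1 p.2)
  map_mem : ∀ g ∈ Da, a g ∈ LocBddSpace O A
  drift_integrable : ∀ g ∈ Da, ∀ᵐ ω ∂P,
    Integrable (fun u => a g u (Function.leftLim (fun s => Y s ω) u)) (dMeas A)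
  drift_adapted : ∀ g ∈ Da, StronglyAdapted F (drift A Y (a g))
  drift_path : ∀ g ∈ Da, ∀ᵐ ω ∂P, Continuous (fun t => drift A Y (a g) t ω) ∧
    BoundedVariationOn (fun t => drift A Y (a g) t ω) univ
  local_martingale : ∀ g ∈ Da,
    IsLocalMartingale F P (fun t ω => g t (Y t ω) - drift A Y (a g) t ω)

/-! ### Exponentials of additive processes -/

/-- `Z = (Z¹,Z²)` is an additive process with respect to the filtration `F`. -/
structure IsAdditiveProcess {Ω : Type*} {mΩ : MeasurableSpace Ω} (F : Filtration (Time T) mΩ)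
    (P : Measure Ω) (Z : Time T → Ω → ℝ × ℝ) : Prop where
  zero : ∀ᵐ ω ∂P, Z ⊥ ω = 0
  cadlag : ∀ ω, IsCadlag (fun t => Z t ω)
  adapted : ∀ t, Measurable[F t] (Z t)
  continuous_in_probability : ∀ t, TendstoInMeasure P Z (𝓝 t) (Z t)
  indep_increments : ∀ u t, u ≤ t →
    Indep (MeasurableSpace.comap (fun ω => Z t ω - Z u ω) inferInstance) (F u) P

end

/-- The open quadrant `]0,∞[²`. -/
def Quadrant : Set (ℝ × ℝ) := {p | 0 < p.1 ∧ 0 < p.2}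

/-- The process `(X,S) = (exp Z¹, exp Z²)`. -/
def expProc {Ω : Type*} (Z : Time T → Ω → ℝ × ℝ) : Time T → Ω → Quadrant :=
  fun t ω => ⟨(Real.exp (Z t ω).1, Real.exp (Z t ω).2), Real.exp_pos _, Real.exp_pos _⟩

/-- `x^{z₁} s^{z₂}` for `x, s > 0`. -/
def cpow2 (p : Quadrant) (z : ℂ × ℂ) : ℂ := ((p.1.1 : ℝ) : ℂ) ^ z.1 * ((p.1.2 : ℝ) : ℂ) ^ z.2

/-- `x^a s^b` for `x, s > 0` and real exponents. -/
def rpow2 (p : Quadrant) (r : ℝ × ℝ) : ℝ := p.1.1 ^ r.1 * p.1.2 ^ r.2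

/-- The pair of real parts. -/
def re2 (z : ℂ × ℂ) : ℝ × ℝ := (z.1.re, z.2.re)

section
variable [Fact ((0 : ℝ) ≤ T)] {Ω : Type*} {mΩ : MeasurableSpace Ω}

/-- `D = {z ∈ ℂ² : E[X_T^{Re z₁} S_T^{Re z₂}] < ∞}`. -/
def expDomain (P : Measure Ω) (Z : Time T → Ω → ℝ × ℝ) : Set (ℂ × ℂ) :=
  {z | Integrable (fun ω => rpow2 (expProc Z ⊤ ω) (re2 z)) P}

open Classical in
/-- The generating function `κ`: for `z ∈ D`, `t ↦ κ_t(z)` is the continuous function with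
`κ_0(z) = 0` and `exp(κ_t(z)) = E[X_t^{z₁} S_t^{z₂}]`. (There is at most one such function.) -/
def genFun (P : Measure Ω) (Z : Time T → Ω → ℝ × ℝ) : Time T → ℂ × ℂ → ℂ :=
  fun t z =>
    if h : ∃ c : Time T → ℂ, Continuous c ∧ c ⊥ = 0 ∧
        ∀ s, Complex.exp (c s) = ∫ ω, cpow2 (expProc Z s ω) z ∂P
    then h.choose t else 0

/-- `ρ^S_t = κ_t(0,2) - 2 κ_t(0,1)`, a real number. -/
def rhoS (P : Measure Ω) (Z : Time T → Ω → ℝ × ℝ) : Time T → ℝ :=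
  fun t => (genFun P Z t (0, 2) - 2 * genFun P Z t (0, 1)).re

/-! ### The domain `D(a)` and the operator `a` -/

/-- The support of a complex measure: the support of its total variation `|Q|`. -/
def msupp (Q : ComplexMeasure (ℂ × ℂ)) : Set (ℂ × ℂ) := Q.variation.support

/-- The integral of a complex function with respect to a complex measure. -/
def cint (Q : ComplexMeasure (ℂ × ℂ)) (F : ℂ × ℂ → ℂ) : ℂ :=
  VectorMeasure.integral Q F (ContinuousLinearMap.mul ℝ ℂ)

/-- `dλ(t,z)/dρ^S_t + λ(t,z) dκ_t(z)/dρ^S_t`, for `z` in the support of `Q`. -/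
def driftDensity (P : Measure Ω) (Z : Time T → Ω → ℝ × ℝ) (Q : ComplexMeasure (ℂ × ℂ))
    (lam : Time T → ℂ × ℂ → ℂ) : Time T → ℂ × ℂ → ℂ :=
  fun t z => jointDensity (rhoS P Z) (msupp Q) lam t z
    + lam t z * jointDensity (rhoS P Z) (msupp Q) (genFun P Z) t z

/-- The conditions on `(Π, λ)`, where `Q` stands for the complex measure `Π`. With
`I₀ = Re (supp Π)`: `I₀` is bounded and contained in `D`, with `E[X_T^a S_T^b]` bounded over
`(a,b) ∈ I₀`; `λ` is Borel; the densities of `λ(·,z)` and `κ(z)` with respect to `ρ^S` exist for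
`z ∈ supp Π`; and the two integrability conditions hold. -/
structure IsAdmissible (P : Measure Ω) (Z : Time T → Ω → ℝ × ℝ) (Q : ComplexMeasure (ℂ × ℂ))
    (lam : Time T → ℂ × ℂ → ℂ) : Prop where
  bounded : Bornology.IsBounded (re2 '' msupp Q)
  subset : msupp Q ⊆ expDomain P Z
  moment_bound : ∃ C : ℝ, ∀ r ∈ re2 '' msupp Q, ∫ ω, rpow2 (expProc Z ⊤ ω) r ∂P ≤ C
  borel : Measurable (Function.uncurry lam)
  genFun_absCont : ∀ z ∈ msupp Q, AbsCont (rhoS P Z) (fun t => genFun P Z t z)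
  absCont : ∀ z ∈ msupp Q, AbsCont (rhoS P Z) (fun t => lam t z)
  sq_integrable : ∀ t, ∫⁻ z, ‖lam t z‖ₑ ^ 2 ∂Q.variation < ∞
  integrable : ∫⁻ t, ∫⁻ z, ‖driftDensity P Z Q lam t z‖ₑ ∂Q.variation ∂(dMeas (rhoS P Z)) < ∞

/-- `f(t,x,s) = ∫ dΠ(z) x^{z₁} s^{z₂} λ(t,z)`. -/
def laplaceFun (Q : ComplexMeasure (ℂ × ℂ)) (lam : Time T → ℂ × ℂ → ℂ) :
    Time T → Quadrant → ℂ :=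
  fun t p => cint Q (fun z => cpow2 p z * lam t z)

/-- `∫ dΠ(z) x^{z₁} s^{z₂} {dλ(t,z)/dρ^S_t + λ(t,z) dκ_t(z)/dρ^S_t}`. -/
def laplaceGen (P : Measure Ω) (Z : Time T → Ω → ℝ × ℝ) (Q : ComplexMeasure (ℂ × ℂ))
    (lam : Time T → ℂ × ℂ → ℂ) : Time T → Quadrant → ℂ :=
  fun t p => cint Q (fun z => cpow2 p z * driftDensity P Z Q lam t z)

/-- The domain `D(a)`. -/
def opDomain (P : Measure Ω) (Z : Time T → Ω → ℝ × ℝ) : Set (Time T → Quadrant → ℂ) :=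
  {f | ∃ Q lam, IsAdmissible P Z Q lam ∧ f = laplaceFun Q lam}

/-- `a` is the operator on `D(a)` given by the formula `laplaceGen`: whatever the representation
`(Π, λ)` of `f ∈ D(a)`, the formula holds for `dρ^S`-almost every `t` and all `x, s > 0`.
(The densities in the formula are themselves defined up to null sets of times.) -/
def IsLaplaceOperator (P : Measure Ω) (Z : Time T → Ω → ℝ × ℝ)
    (a : (Time T → Quadrant → ℂ) → (Time T → Quadrant → ℂ)) : Prop :=
  ∀ Q lam, IsAdmissible P Z Q lam →
    ∀ᵐ t ∂(dMeas (rhoS P Z)), ∀ p, a (laplaceFun Q lam) t p = laplaceGen P Z Q lam t p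

end

end StrongMP

end

open MeasureTheory ProbabilityTheory Filter Set
open scoped Topology ENNReal

noncomputable section

namespace StrongMP

variable {T : ℝ}

/-! ### Polar decomposition of complex measures -/

section ComplexMeasure

variable {X : Type*} {mX : MeasurableSpace X}

instance isFiniteMeasure_variation_complexMeasure (Q : ComplexMeasure X) :
    IsFiniteMeasure Q.variation := by
  have hre : IsFiniteMeasure (ComplexMeasure.re Q).totalVariation := inferInstance
  have him : IsFiniteMeasure (ComplexMeasure.im Q).totalVariation := inferInstance
  refine isFiniteMeasure_of_le
    ((ComplexMeasure.re Q).totalVariation + (ComplexMeasure.im Q).totalVariation) ?_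
  refine VectorMeasure.variation_le_of_forall_enorm_le fun E hE => ?_
  rw [Measure.add_apply]
  refine le_trans ?_ (add_le_add (SignedMeasure.enorm_le_totalVariation _ E)
    (SignedMeasure.enorm_le_totalVariation _ E))
  have h : Q E = ((ComplexMeasure.re Q E : ℝ) : ℂ)
      + ((ComplexMeasure.im Q E : ℝ) : ℂ) * Complex.I := by
    conv_lhs => rw [← Complex.re_add_im (Q E)]
    rfl
  rw [h]
  refine (enorm_add_le _ _).trans ?_
  simp [← ofReal_norm, Complex.norm_I]

theorem exists_withDensityᵥ_variation (Q : ComplexMeasure X) :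
    ∃ h : X → ℂ, Measurable h ∧ Integrable h Q.variation ∧
      Q = Q.variation.withDensityᵥ h := by
  have hac := (ComplexMeasure.absolutelyContinuous_ennreal_iff Q _).1 Q.absolutelyContinuous
  have h1 := SignedMeasure.withDensityᵥ_rnDeriv_eq _ Q.variation hac.1
  have h2 := SignedMeasure.withDensityᵥ_rnDeriv_eq _ Q.variation hac.2
  have hm : Measurable (fun x => (((ComplexMeasure.re Q).rnDeriv Q.variation x : ℝ) : ℂ)
      + (((ComplexMeasure.im Q).rnDeriv Q.variation x : ℝ) : ℂ) * Complex.I) :=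
    (Complex.measurable_ofReal.comp (SignedMeasure.measurable_rnDeriv _ _)).add
      ((Complex.measurable_ofReal.comp (SignedMeasure.measurable_rnDeriv _ _)).mul_const _)
  have i1 : Integrable (fun x => (((ComplexMeasure.re Q).rnDeriv Q.variation x : ℝ) : ℂ))
      Q.variation := (SignedMeasure.integrable_rnDeriv _ _).ofReal
  have i2 : Integrable (fun x => (((ComplexMeasure.im Q).rnDeriv Q.variation x : ℝ) : ℂ)
      * Complex.I) Q.variation := (SignedMeasure.integrable_rnDeriv _ _).ofReal.mul_const _
  refine ⟨_, hm, i1.add i2, ?_⟩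
  refine VectorMeasure.ext fun s hs => ?_
  refine Eq.trans ?_ (withDensityᵥ_apply (i1.add i2) hs).symm
  have e := integral_add (μ := Q.variation.restrict s) i1.restrict i2.restrict
  simp only [Pi.add_apply] at e ⊢
  rw [e, integral_mul_const, integral_complex_ofReal, integral_complex_ofReal,
    ← withDensityᵥ_apply (SignedMeasure.integrable_rnDeriv _ _) hs,
    ← withDensityᵥ_apply (SignedMeasure.integrable_rnDeriv _ _) hs, h1, h2]
  conv_lhs => rw [← Complex.re_add_im (Q s)]
  rfl

/-- The polar decomposition of a complex measure. -/
theorem exists_polar (Q : ComplexMeasure X) :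
    ∃ h : X → ℂ, Measurable h ∧ (∀ x, ‖h x‖ = 1) ∧ Q = Q.variation.withDensityᵥ h := by
  classical
  obtain ⟨h, hm, hi, hQ⟩ := exists_withDensityᵥ_variation Q
  have hv : Q.variation = Q.variation.withDensity (fun x => ‖h x‖ₑ) := by
    conv_lhs => rw [hQ]
    exact Measure.variation_withDensityᵥ hi
  have h1 : (fun x => ‖h x‖ₑ) =ᵐ[Q.variation] fun _ => 1 := by
    refine (withDensity_eq_iff hm.enorm.aemeasurable aemeasurable_const ?_).1 ?_
    · exact hi.2.ne
    · rw [← hv]; exact (withDensity_one).symm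
  have hset : MeasurableSet {x | ‖h x‖ = 1} := measurableSet_eq_fun hm.norm measurable_const
  refine ⟨fun x => if ‖h x‖ = 1 then h x else 1,
    Measurable.ite hset hm measurable_const, fun x => ?_, ?_⟩
  · by_cases hx : ‖h x‖ = 1 <;> simp [hx]
  · conv_lhs => rw [hQ]
    refine WithDensityᵥEq.congr_ae ?_
    filter_upwards [h1] with x hx
    have : ‖h x‖ = 1 := by simpa [enorm_eq_nnnorm, ← NNReal.coe_inj] using hx
    simp [this]

theorem integral_polar {Q : ComplexMeasure X} {h : X → ℂ} (hm : Measurable h)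
    (h1 : ∀ x, ‖h x‖ = 1) (hQ : Q = Q.variation.withDensityᵥ h) (F : X → ℂ) :
    VectorMeasure.integral Q F (ContinuousLinearMap.mul ℝ ℂ) = ∫ x, F x * h x ∂Q.variation := by
  have hb : ∀ᵐ x ∂Q.variation, ‖h x‖ ≤ 1 := ae_of_all _ fun x => (h1 x).le
  have hi : Integrable h Q.variation := Integrable.of_bound hm.aestronglyMeasurable 1 hb
  by_cases hF : Integrable F Q.variation
  swap
  · rw [VectorMeasure.integral_undef hF, integral_undef]
    intro hc
    refine hF ((hc.mul_bdd (c := 1) (f := fun x => F x * h x) (g := fun x => (h x)⁻¹)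
      hm.inv.aestronglyMeasurable (ae_of_all _ fun x => by simp [h1])).congr ?_)
    refine ae_of_all _ fun x => ?_
    have : h x ≠ 0 := fun h0 => by simpa [h0] using h1 x
    simp [this]
  refine Integrable.induction (μ := Q.variation) (fun F =>
    VectorMeasure.integral Q F (ContinuousLinearMap.mul ℝ ℂ) = ∫ x, F x * h x ∂Q.variation)
    ?_ ?_ ?_ ?_ hF
  · intro c s hs _
    rw [VectorMeasure.integral_indicator hs, VectorMeasure.integral_const]
    simp only [VectorMeasure.restrict_apply Q hs MeasurableSet.univ, univ_inter,
      ContinuousLinearMap.mul_apply']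
    have e : (fun x => s.indicator (fun _ => c) x * h x) = s.indicator (fun x => c * h x) := by
      ext x; by_cases hx : x ∈ s <;> simp [hx]
    rw [e, integral_indicator hs, integral_const_mul, ← withDensityᵥ_apply hi hs, ← hQ]
  · intro f g _ hf hg ef eg
    rw [VectorMeasure.integral_add hf hg, ef, eg, ← integral_add]
    · simp [add_mul]
    · exact hf.mul_bdd hm.aestronglyMeasurable hb
    · exact hg.mul_bdd hm.aestronglyMeasurable hb
  · refine isClosed_eq VectorMeasure.continuous_integral ?_
    refine Metric.continuous_iff.2 fun f ε hε => ⟨ε, hε, fun g hg => ?_⟩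
    rw [dist_eq_norm, ← integral_sub]
    rotate_left
    · exact (L1.integrable_coeFn g).mul_bdd hm.aestronglyMeasurable hb
    · exact (L1.integrable_coeFn f).mul_bdd hm.aestronglyMeasurable hb
    refine lt_of_le_of_lt (norm_integral_le_integral_norm _) ?_
    rw [dist_eq_norm, L1.norm_eq_integral_norm] at hg
    refine lt_of_eq_of_lt (integral_congr_ae ?_) hg
    filter_upwards [Lp.coeFn_sub g f] with x hx
    simp only [hx, Pi.sub_apply, ← sub_mul, norm_mul, h1, mul_one]
  · intro f g hfg _ ef
    rw [← VectorMeasure.integral_congr_ae hfg, ef]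
    exact integral_congr_ae (by filter_upwards [hfg] with x hx; rw [hx])

end ComplexMeasure

/-! ### The measure `dA` of a continuous nondecreasing function -/

section Integrator

variable [Fact ((0 : ℝ) ≤ T)] {A : Time T → ℝ}

theorem dMeas_Ioc (hA : Continuous A) (hm : Monotone A) (a b : Time T) :
    dMeas A (Ioc a b) = ENNReal.ofReal (A b - A a) := by
  rw [dMeas, dif_pos hm, StieltjesFunction.measure_Ioc, hm.stieltjesFunction_eq,
    hm.stieltjesFunction_eq, hA.continuousAt.continuousWithinAt.rightLim_eq,
    hA.continuousAt.continuousWithinAt.rightLim_eq]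

theorem dMeas_singleton (hA : Continuous A) (a : Time T) : dMeas A {a} = 0 := by
  by_cases hm : Monotone A
  · have h : (hm.stieltjesFunction : Time T → ℝ) = A := by
      funext x
      rw [hm.stieltjesFunction_eq, hA.continuousAt.continuousWithinAt.rightLim_eq]
    rw [dMeas, dif_pos hm, StieltjesFunction.measure_singleton, h,
      hA.continuousAt.continuousWithinAt.leftLim_eq, sub_self, ENNReal.ofReal_zero]
  · simp [dMeas, hm]

theorem nullSingletonClass_dMeas (hA : Continuous A) : NullSingletonClass (dMeas A) := ⟨dMeas_singleton hA⟩

theorem isFiniteMeasure_dMeas (hA : Continuous A) (hm : Monotone A) :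
    IsFiniteMeasure (dMeas A) := by
  refine ⟨?_⟩
  have h : (univ : Set (Time T)) = {⊥} ∪ Ioc ⊥ ⊤ := by
    ext x
    rcases eq_or_ne x ⊥ with h | h <;> simp [h]
  rw [h]
  refine (measure_union_le _ _).trans_lt ?_
  rw [dMeas_singleton hA, dMeas_Ioc hA hm]
  simp

omit [Fact ((0 : ℝ) ≤ T)] in
theorem continuous_setIntegral_Iic {μ : Measure (Time T)} [NullSingletonClass μ] {ψ : Time T → ℂ}
    (hψ : Integrable ψ μ) : Continuous (fun t => ∫ u in Iic t, ψ u ∂μ) := by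
  simp_rw [← integral_indicator (μ := μ) measurableSet_Iic]
  refine continuous_iff_continuousAt.2 fun t => ?_
  refine continuousAt_of_dominated (bound := fun u => ‖ψ u‖) ?_ ?_ hψ.norm ?_
  · exact Eventually.of_forall fun s => hψ.aestronglyMeasurable.indicator measurableSet_Iic
  · exact Eventually.of_forall fun s => ae_of_all _ fun u => norm_indicator_le_norm_self _ _
  · have hne : ∀ᵐ u ∂μ, u ≠ t := by
      simp [ae_iff]
    filter_upwards [hne] with u hu
    rcases lt_or_gt_of_ne hu with h | h
    · refine (continuousAt_const (y := ψ u)).congr ?_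
      filter_upwards [lt_mem_nhds h] with s hs
      simp [hs.le]
    · refine (continuousAt_const (y := (0 : ℂ))).congr ?_
      filter_upwards [gt_mem_nhds h] with s hs
      simp [hs]

omit [Fact ((0 : ℝ) ≤ T)] in
theorem setIntegral_Ioc_eq_sub {μ : Measure (Time T)} {ψ : Time T → ℂ}
    (hψ : Integrable ψ μ) {s t : Time T} (hst : s ≤ t) :
    ∫ u in Ioc s t, ψ u ∂μ = (∫ u in Iic t, ψ u ∂μ) - ∫ u in Iic s, ψ u ∂μ := by
  rw [← Iic_union_Ioc_eq_Iic hst, setIntegral_union (Iic_disjoint_Ioc le_rfl) measurableSet_Ioc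
    hψ.integrableOn hψ.integrableOn]
  ring

theorem boundedVariationOn_setIntegral_Iic {μ : Measure (Time T)} {ψ : Time T → ℂ}
    (hψ : Integrable ψ μ) : BoundedVariationOn (fun t => ∫ u in Iic t, ψ u ∂μ) univ := by
  set g : Time T → ℝ := fun t => ∫ u in Iic t, ‖ψ u‖ ∂μ with hg
  have hgm : Monotone g := fun s t hst =>
    setIntegral_mono_set hψ.norm.integrableOn (ae_of_all _ fun _ => norm_nonneg _)
      (Iic_subset_Iic.2 hst).eventuallyLE
  have hgb : BoundedVariationOn g univ := by
    have h := (hgm.monotoneOn univ).locallyBoundedVariationOn ⊥ ⊤ trivial trivial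
    simpa using h
  have hle : ∀ s t, s ≤ t →
      edist (∫ u in Iic t, ψ u ∂μ) (∫ u in Iic s, ψ u ∂μ) ≤ edist (g t) (g s) := by
    intro s t hst
    rw [edist_dist, edist_dist, dist_eq_norm, dist_eq_norm, ← setIntegral_Ioc_eq_sub hψ hst]
    refine ENNReal.ofReal_le_ofReal ?_
    refine (norm_integral_le_integral_norm _).trans ?_
    rw [Real.norm_eq_abs]
    refine le_trans (le_of_eq ?_) (le_abs_self _)
    simp only [hg]
    rw [← Iic_union_Ioc_eq_Iic hst, setIntegral_union (Iic_disjoint_Ioc le_rfl)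
      measurableSet_Ioc hψ.norm.integrableOn hψ.norm.integrableOn]
    ring
  refine ne_top_of_le_ne_top hgb ?_
  refine iSup_le fun p => ?_
  refine le_trans (Finset.sum_le_sum fun i _ => hle _ _ (p.2.2.1 (Nat.le_succ i)))
    (eVariationOn.sum_le (f := g) (s := univ) (n := p.1) p.2.2.1 fun i => mem_univ _)
theorem ae_eq_zero_of_setIntegral_Iic {μ : Measure (Time T)} {ψ : Time T → ℂ}
    (hψ : Integrable ψ μ) (h : ∀ t, ∫ u in Iic t, ψ u ∂μ = 0) : ψ =ᵐ[μ] 0 := by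
  refine hψ.ae_eq_of_withDensityᵥ_eq (integrable_zero _ _ _) ?_
  rw [withDensityᵥ_zero]
  refine VectorMeasure.ext_of_generateFrom (range Iic) ?_ ?_ isPiSystem_Iic ?_
  · rintro _ ⟨t, rfl⟩
    rw [withDensityᵥ_apply hψ measurableSet_Iic, h]
    rfl
  · rw [← borel_eq_generateFrom_Iic]
    exact BorelSpace.measurable_eq
  · rw [withDensityᵥ_apply hψ MeasurableSet.univ, ← Iic_top, h]
    rfl

/-! ### Calculus of densities -/

theorem IsDensity.sub_eq {φ ψ : Time T → ℂ} (h : IsDensity A φ ψ) {s t : Time T} (hst : s ≤ t) :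
    φ t - φ s = ∫ u in Ioc s t, ψ u ∂(dMeas A) := by
  rw [setIntegral_Ioc_eq_sub h.1 hst, h.2 t, h.2 s]
  ring

theorem IsDensity.continuous (hA : Continuous A) {φ ψ : Time T → ℂ} (h : IsDensity A φ ψ) :
    Continuous φ := by
  have := nullSingletonClass_dMeas hA
  have e : φ = fun t => φ ⊥ + ∫ u in Iic t, ψ u ∂(dMeas A) := funext h.2
  rw [e]
  exact continuous_const.add (continuous_setIntegral_Iic h.1)

omit [Fact ((0 : ℝ) ≤ T)] in
theorem _root_.Continuous.exists_norm_le {φ : Time T → ℂ} (h : Continuous φ) :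
    ∃ C, ∀ t, ‖φ t‖ ≤ C := by
  obtain ⟨C, hC⟩ := isCompact_univ.exists_bound_of_continuousOn h.continuousOn
  exact ⟨C, fun t => hC t trivial⟩

theorem IsDensity.const (c : ℂ) : IsDensity A (fun _ => c) (fun _ => 0) :=
  ⟨integrable_zero _ _ _, fun t => by simp⟩

theorem IsDensity.add {φ ψ χ θ : Time T → ℂ} (h : IsDensity A φ ψ) (h' : IsDensity A χ θ) :
    IsDensity A (fun t => φ t + χ t) (fun t => ψ t + θ t) :=
  ⟨h.1.add h'.1, fun t => by
    beta_reduce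
    rw [integral_add h.1.integrableOn h'.1.integrableOn, h.2 t, h'.2 t]; ring⟩

theorem IsDensity.const_mul {φ ψ : Time T → ℂ} (c : ℂ) (h : IsDensity A φ ψ) :
    IsDensity A (fun t => c * φ t) (fun t => c * ψ t) :=
  ⟨h.1.const_mul c, fun t => by beta_reduce; rw [integral_const_mul, h.2 t]; ring⟩

omit [Fact ((0 : ℝ) ≤ T)] in
theorem setIntegral_Iic_mul_setIntegral_Iic {μ : Measure (Time T)} [NullSingletonClass μ] [IsFiniteMeasure μ]
    {ψ θ : Time T → ℂ} (hψ : Integrable ψ μ) (hθ : Integrable θ μ) (t : Time T) :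
    (∫ u in Iic t, ψ u ∂μ) * ∫ u in Iic t, θ u ∂μ
      = ∫ u in Iic t, (ψ u * (∫ v in Iic u, θ v ∂μ) + (∫ v in Iic u, ψ v ∂μ) * θ u) ∂μ := by
  obtain ⟨C, hC⟩ := (continuous_setIntegral_Iic hψ).exists_norm_le
  obtain ⟨D, hD⟩ := (continuous_setIntegral_Iic hθ).exists_norm_le
  have i1 : Integrable (fun u => ψ u * ∫ v in Iic u, θ v ∂μ) μ :=
    hψ.mul_bdd (continuous_setIntegral_Iic hθ).aestronglyMeasurable (ae_of_all _ hD)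
  have i2 : Integrable (fun u => (∫ v in Iic u, ψ v ∂μ) * θ u) μ :=
    hθ.bdd_mul (continuous_setIntegral_Iic hψ).aestronglyMeasurable (ae_of_all _ hC)
  have hset : MeasurableSet {p : Time T × Time T | p.1 < p.2} :=
    measurableSet_lt measurable_fst measurable_snd
  have hprod : Integrable (fun p : Time T × Time T =>
      {p : Time T × Time T | p.1 < p.2}.indicator (fun p => ψ p.1 * θ p.2) p)
      ((μ.restrict (Iic t)).prod (μ.restrict (Iic t))) :=
    (hψ.restrict.mul_prod hθ.restrict).indicator hset
  have hswap := integral_integral_swap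
    (f := fun u v => {p : Time T × Time T | p.1 < p.2}.indicator (fun p => ψ p.1 * θ p.2) (u, v))
    hprod
  have e1 : ∀ u ∈ Iic t, ∫ v in Iic t, {p : Time T × Time T | p.1 < p.2}.indicator
      (fun p => ψ p.1 * θ p.2) (u, v) ∂μ
      = ψ u * (∫ v in Iic t, θ v ∂μ) - ψ u * ∫ v in Iic u, θ v ∂μ := by
    intro u hu
    have : (fun v => {p : Time T × Time T | p.1 < p.2}.indicator
        (fun p => ψ p.1 * θ p.2) (u, v)) = (Ioi u).indicator (fun v => ψ u * θ v) := by
      ext v; by_cases h : u < v <;> simp [h]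
    rw [this, setIntegral_indicator measurableSet_Ioi, integral_const_mul, ← mul_sub,
      ← setIntegral_Ioc_eq_sub hθ hu]
    congr 2
    rw [inter_comm, Ioi_inter_Iic]
  have e2 : ∀ v ∈ Iic t, ∫ u in Iic t, {p : Time T × Time T | p.1 < p.2}.indicator
      (fun p => ψ p.1 * θ p.2) (u, v) ∂μ = (∫ u in Iic v, ψ u ∂μ) * θ v := by
    intro v hv
    have : (fun u => {p : Time T × Time T | p.1 < p.2}.indicator
        (fun p => ψ p.1 * θ p.2) (u, v)) = (Iio v).indicator (fun u => ψ u * θ v) := by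
      ext u; by_cases h : u < v <;> simp [h]
    rw [this, setIntegral_indicator measurableSet_Iio, integral_mul_const,
      inter_eq_right.2 (Iio_subset_Iic_self.trans (Iic_subset_Iic.2 hv)), setIntegral_congr_set Iio_ae_eq_Iic]
  rw [setIntegral_congr_fun measurableSet_Iic e1, setIntegral_congr_fun measurableSet_Iic e2,
    integral_sub (hψ.mul_const _).restrict i1.restrict, integral_mul_const] at hswap
  rw [integral_add i1.restrict i2.restrict, ← hswap]
  ring

theorem IsDensity.mul (hA : Continuous A) (hm : Monotone A) {φ ψ χ θ : Time T → ℂ}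
    (h : IsDensity A φ ψ) (h' : IsDensity A χ θ) :
    IsDensity A (fun t => φ t * χ t) (fun t => ψ t * χ t + φ t * θ t) := by
  have := nullSingletonClass_dMeas hA
  have := isFiniteMeasure_dMeas hA hm
  obtain ⟨C, hC⟩ := (h.continuous hA).exists_norm_le
  obtain ⟨D, hD⟩ := (h'.continuous hA).exists_norm_le
  have i1 : Integrable (fun t => ψ t * χ t) (dMeas A) :=
    h.1.mul_bdd (h'.continuous hA).aestronglyMeasurable (ae_of_all _ hD)
  have i2 : Integrable (fun t => φ t * θ t) (dMeas A) :=
    h'.1.bdd_mul (h.continuous hA).aestronglyMeasurable (ae_of_all _ hC)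
  refine ⟨i1.add i2, fun t => ?_⟩
  have key := setIntegral_Iic_mul_setIntegral_Iic h.1 h'.1 t
  have e : ∀ u, ψ u * χ u + φ u * θ u = (ψ u * χ ⊥ + φ ⊥ * θ u)
      + (ψ u * (∫ v in Iic u, θ v ∂(dMeas A)) + (∫ v in Iic u, ψ v ∂(dMeas A)) * θ u) := by
    intro u
    rw [h.2 u, h'.2 u]
    ring
  have j1 : Integrable (fun u => ψ u * χ ⊥ + φ ⊥ * θ u) (dMeas A) :=
    (h.1.mul_const _).add (h'.1.const_mul _)
  have j2 : Integrable (fun u => ψ u * (∫ v in Iic u, θ v ∂(dMeas A))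
      + (∫ v in Iic u, ψ v ∂(dMeas A)) * θ u) (dMeas A) := by
    refine ((i1.add i2).sub j1).congr (ae_of_all _ fun u => ?_)
    simp only [Pi.sub_apply, Pi.add_apply, e]
    ring
  simp_rw [e]
  rw [integral_add j1.restrict j2.restrict, ← key,
    integral_add (h.1.mul_const _).restrict (h'.1.const_mul _).restrict, integral_mul_const,
    integral_const_mul, h.2 t, h'.2 t]
  ring

theorem IsDensity.pow (hA : Continuous A) (hm : Monotone A) {φ ψ : Time T → ℂ}
    (h : IsDensity A φ ψ) (n : ℕ) :
    IsDensity A (fun t => φ t ^ n) (fun t => n * φ t ^ (n - 1) * ψ t) := by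
  induction n with
  | zero => simpa using IsDensity.const (A := A) 1
  | succ n ih =>
    have := ih.mul hA hm h
    have e : (fun t => ((n + 1 : ℕ) : ℂ) * φ t ^ (n + 1 - 1) * ψ t)
        = fun t => n * φ t ^ (n - 1) * ψ t * φ t + φ t ^ n * ψ t := by
      funext t
      rcases n with _ | m
      · simp
      · rw [Nat.add_sub_cancel, Nat.add_sub_cancel]
        push_cast
        ring
    rw [e]
    exact this

theorem IsDensity.sum {ι : Type*} (s : Finset ι) {φ ψ : ι → Time T → ℂ}
    (h : ∀ i ∈ s, IsDensity A (φ i) (ψ i)) :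
    IsDensity A (fun t => ∑ i ∈ s, φ i t) (fun t => ∑ i ∈ s, ψ i t) := by
  classical
  induction s using Finset.induction_on with
  | empty => simpa using IsDensity.const (A := A) 0
  | insert i s hi ih =>
    simp only [Finset.sum_insert hi]
    exact (h i (Finset.mem_insert_self _ _)).add
      (ih fun j hj => h j (Finset.mem_insert_of_mem hj))

theorem IsDensity.cexp (hA : Continuous A) (hm : Monotone A) {φ ψ : Time T → ℂ}
    (h : IsDensity A φ ψ) :
    IsDensity A (fun t => Complex.exp (φ t)) (fun t => Complex.exp (φ t) * ψ t) := by
  obtain ⟨C, hC⟩ := (h.continuous hA).exists_norm_le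
  have hexp : ∀ z : ℂ, Tendsto (fun N => ∑ n ∈ Finset.range N, ((n.factorial : ℂ))⁻¹ * z ^ n) atTop
      (𝓝 (Complex.exp z)) := by
    intro z
    have := (NormedSpace.exp_series_hasSum_exp' (𝕂 := ℂ) z).tendsto_sum_nat
    simpa [smul_eq_mul, ← Complex.exp_eq_exp_ℂ] using this
  have hN : ∀ N, IsDensity A (fun t => ∑ n ∈ Finset.range (N + 1), ((n.factorial : ℂ))⁻¹ * φ t ^ n)
      (fun t => (∑ n ∈ Finset.range N, ((n.factorial : ℂ))⁻¹ * φ t ^ n) * ψ t) := by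
    intro N
    have := IsDensity.sum (Finset.range (N + 1))
      fun n _ => (h.pow hA hm n).const_mul ((n.factorial : ℂ))⁻¹
    convert this using 2 with t
    rw [Finset.sum_range_succ', Finset.sum_mul]
    simp only [Nat.cast_zero, zero_mul, mul_zero, add_zero, Nat.add_sub_cancel]
    refine Finset.sum_congr rfl fun n _ => ?_
    have h0 : (n.factorial : ℂ) ≠ 0 := by exact_mod_cast n.factorial_ne_zero
    have h1 : ((n : ℂ) + 1) ≠ 0 := by exact_mod_cast n.succ_ne_zero
    rw [Nat.factorial_succ]
    push_cast
    field_simp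
  have hbd : ∀ N t, ‖∑ n ∈ Finset.range N, ((n.factorial : ℂ))⁻¹ * φ t ^ n‖ ≤ Real.exp C := by
    intro N t
    refine (norm_sum_le _ _).trans (le_trans ?_ (Real.exp_le_exp.2 (hC t)))
    refine le_trans (le_of_eq ?_) (Real.sum_le_exp_of_nonneg (norm_nonneg (φ t)) N)
    refine Finset.sum_congr rfl fun n _ => ?_
    simp [div_eq_inv_mul]
  have hint : Integrable (fun t => Complex.exp (φ t) * ψ t) (dMeas A) := by
    refine h.1.bdd_mul (c := Real.exp C)
      (Complex.continuous_exp.comp (h.continuous hA)).aestronglyMeasurable (ae_of_all _ fun t => ?_)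
    rw [Complex.norm_exp]
    exact Real.exp_le_exp.2 (((Complex.re_le_norm _)).trans (hC t))
  refine ⟨hint, fun t => ?_⟩
  have l1 := (hexp (φ t)).comp (tendsto_add_atTop_nat 1)
  have l2 := (hexp (φ ⊥)).comp (tendsto_add_atTop_nat 1)
  have l3 : Tendsto (fun N => ∫ u in Iic t,
      (∑ n ∈ Finset.range N, ((n.factorial : ℂ))⁻¹ * φ u ^ n) * ψ u ∂(dMeas A)) atTop
      (𝓝 (∫ u in Iic t, Complex.exp (φ u) * ψ u ∂(dMeas A))) := by
    refine tendsto_integral_of_dominated_convergence (fun u => Real.exp C * ‖ψ u‖)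
      (fun N => (hN N).1.aestronglyMeasurable.restrict) (h.1.norm.const_mul _).restrict
      (fun N => ae_of_all _ fun u => ?_) (ae_of_all _ fun u => (hexp (φ u)).mul_const _)
    rw [norm_mul]
    exact mul_le_mul_of_nonneg_right (hbd N u) (norm_nonneg _)
  refine tendsto_nhds_unique l1 ((l2.add l3).congr fun N => ?_)
  exact ((hN N).2 t).symm

end Integrator

/-! ### Jointly measurable densities -/

section JointDensity

variable [Fact ((0 : ℝ) ≤ T)] {A : Time T → ℝ}

theorem map_dMeas (hA : Continuous A) (hm : Monotone A) :
    (dMeas A).map A = volume.restrict (Ioc (A ⊥) (A ⊤)) := by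
  have := isFiniteMeasure_dMeas hA hm
  have : IsFiniteMeasure ((dMeas A).map A) := Measure.isFiniteMeasure_map _ _
  refine Measure.ext_of_Iic _ _ fun x => ?_
  rw [Measure.map_apply hA.measurable measurableSet_Iic,
    Measure.restrict_apply measurableSet_Iic, inter_comm, Ioc_inter_Iic, Real.volume_Ioc]
  have hbot : ∀ s : Set (Time T), dMeas A s = dMeas A (s \ {⊥}) := fun s =>
    (measure_sdiff_null (dMeas_singleton hA ⊥)).symm
  rcases lt_or_ge x (A ⊥) with h | h
  · have e : A ⁻¹' Iic x = ∅ := by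
      ext u
      simpa using h.trans_le (hm bot_le)
    rw [e, measure_empty, eq_comm, ENNReal.ofReal_eq_zero]
    exact (sub_nonpos.2 ((min_le_right _ _).trans h.le))
  · obtain ⟨t, ht⟩ : ∃ t, A t = min (A ⊤) x :=
      mem_range_of_exists_le_of_exists_ge hA ⟨⊥, le_min (hm bot_le) h⟩ ⟨⊤, min_le_left _ _⟩
    have e : A ⁻¹' Iic x = A ⁻¹' Iic (A t) := by
      ext u
      simp [ht, hm le_top]
    rw [← ht, ← dMeas_Ioc hA hm, e]
    have hsub : Ioc ⊥ t ⊆ A ⁻¹' Iic (A t) := fun u hu => hm hu.2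
    refine le_antisymm ?_ (measure_mono hsub)
    have hcov : A ⁻¹' Iic (A t) ⊆ Ioc ⊥ t ∪ ({⊥} ∪ {u | t < u ∧ A u = A t}) := by
      intro u hu
      rcases eq_or_ne u ⊥ with h0 | h0
      · exact Or.inr (Or.inl h0)
      rcases le_or_gt u t with h1 | h1
      · exact Or.inl ⟨bot_lt_iff_ne_bot.2 h0, h1⟩
      · exact Or.inr (Or.inr ⟨h1, le_antisymm hu (hm h1.le)⟩)
    refine (measure_mono hcov).trans ((measure_union_le _ _).trans ?_)
    have hz : dMeas A {u | t < u ∧ A u = A t} = 0 := by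
      have hcl : IsClosed {u : Time T | A u = A t} := isClosed_eq hA continuous_const
      obtain ⟨w, hw⟩ := hcl.isCompact.exists_isGreatest ⟨t, rfl⟩
      refine measure_mono_null (t := Ioc t w) (fun u hu => ⟨hu.1, hw.2 hu.2⟩) ?_
      rw [dMeas_Ioc hA hm, hw.1, sub_self, ENNReal.ofReal_zero]
    rw [measure_union_null (dMeas_singleton hA ⊥) hz, add_zero]

theorem ae_tendsto_of_isDensity (hA : Continuous A) (hm : StrictMono A) {σ : ℝ → Time T}
    (hσ : ∀ t, σ (A t) = t) {φ ψ : Time T → ℂ} (h : IsDensity A φ ψ) :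
    ∀ᵐ t ∂(dMeas A), Tendsto (fun n : ℕ => ((n : ℂ) + 1) *
      (φ (σ (A t + 1 / ((n : ℝ) + 1))) - φ t)) atTop (𝓝 (ψ t)) := by
  have hemb : MeasurableEmbedding A := hA.measurableEmbedding hm.injective
  set g : ℝ → ℂ := (Ioc (A ⊥) (A ⊤)).indicator (Function.extend A ψ 0) with hg
  have hgi : Integrable g volume := by
    rw [hg, integrable_indicator_iff measurableSet_Ioc, IntegrableOn, ← map_dMeas hA hm.monotone,
      hemb.integrable_map_iff]
    refine h.1.congr (ae_of_all _ fun t => ?_)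
    exact (hm.injective.extend_apply ψ 0 t).symm
  have hgA : ∀ t, t ≠ ⊥ → g (A t) = ψ t := by
    intro t ht
    rw [hg, indicator_of_mem (show A t ∈ Ioc (A ⊥) (A ⊤) from
        ⟨hm (bot_lt_iff_ne_bot.2 ht), hm.monotone le_top⟩),
      hm.injective.extend_apply]
  have hint : ∀ t, ∫ x in (A ⊥)..(A t), g x = φ t - φ ⊥ := by
    intro t
    rw [h.sub_eq bot_le, intervalIntegral.integral_of_le (hm.monotone bot_le), hg,
      setIntegral_indicator measurableSet_Ioc, ← Measure.restrict_restrict measurableSet_Ioc,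
      ← map_dMeas hA hm.monotone, hemb.setIntegral_map]
    have e : A ⁻¹' Ioc (A ⊥) (A t) = Ioc ⊥ t := by
      ext u
      simp [hm.lt_iff_lt, hm.le_iff_le]
    rw [e]
    exact setIntegral_congr_fun measurableSet_Ioc fun u _ => hm.injective.extend_apply ψ 0 u
  have hae : ∀ᵐ t ∂(dMeas A),
      HasDerivAt (fun x => ∫ y in (A ⊥)..x, g y) (g (A t)) (A t) := by
    have h1 := LocallyIntegrable.ae_hasDerivAt_integral hgi.locallyIntegrable
    have h2 : ∀ᵐ x ∂((dMeas A).map A), ∀ c, HasDerivAt (fun x => ∫ y in c..x, g y) (g x) x := by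
      rw [map_dMeas hA hm.monotone]
      exact ae_restrict_of_ae h1
    filter_upwards [ae_of_ae_map hA.measurable.aemeasurable h2] with t ht using ht _
  have hne : ∀ a : Time T, ∀ᵐ t ∂(dMeas A), t ≠ a := fun a => by
    simp [ae_iff, dMeas_singleton hA]
  filter_upwards [hae, hne ⊥, hne ⊤] with t ht hb htop
  rw [← hgA t hb]
  have hseq : Tendsto (fun n : ℕ => A t + 1 / ((n : ℝ) + 1)) atTop (𝓝[≠] (A t)) := by
    refine tendsto_nhdsWithin_iff.2 ⟨?_, Eventually.of_forall fun n => ?_⟩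
    · simpa using tendsto_const_nhds.add (tendsto_one_div_add_atTop_nhds_zero_nat (𝕜 := ℝ))
    · have : (0 : ℝ) < 1 / ((n : ℝ) + 1) := by positivity
      exact (lt_add_of_pos_right _ this).ne'
  have hslope := (hasDerivAt_iff_tendsto_slope.1 ht).comp hseq
  refine hslope.congr' ?_
  have hlt : ∀ᶠ n : ℕ in atTop, A t + 1 / ((n : ℝ) + 1) < A ⊤ :=
    (hseq.mono_right nhdsWithin_le_nhds).eventually_lt_const
      (hm (lt_top_iff_ne_top.2 htop))
  filter_upwards [hlt] with n hn
  have hpos : (0 : ℝ) < 1 / ((n : ℝ) + 1) := by positivity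
  obtain ⟨s, hs⟩ : ∃ s, A s = A t + 1 / ((n : ℝ) + 1) :=
    mem_range_of_exists_le_of_exists_ge hA ⟨t, (lt_add_of_pos_right _ hpos).le⟩ ⟨⊤, hn.le⟩
  have h0 : ((n : ℂ) + 1) ≠ 0 := by exact_mod_cast n.succ_ne_zero
  simp only [Function.comp, slope, vsub_eq_sub, ← hs, hσ, hint]
  rw [hs, add_sub_cancel_left, Complex.real_smul]
  push_cast
  field_simp
  ring

theorem exists_measurable_density (hA : Continuous A) (hm : StrictMono A) {E : Type*}
    [MeasurableSpace E] {G : Set E} {φ : Time T → E → ℂ}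
    (hφ : Measurable (Function.uncurry φ)) (h : ∀ z ∈ G, AbsCont A (fun t => φ t z)) :
    ∃ ψ : Time T → E → ℂ, Measurable (Function.uncurry ψ) ∧
      ∀ z ∈ G, IsDensity A (fun t => φ t z) (fun t => ψ t z) := by
  have hemb : MeasurableEmbedding A := hA.measurableEmbedding hm.injective
  set σ : ℝ → Time T := Function.extend A id (fun _ => ⊥) with hσdef
  have hσm : Measurable σ := hemb.measurable_extend measurable_id measurable_const
  have hσ : ∀ t, σ (A t) = t := fun t => hm.injective.extend_apply _ _ t
  set D : ℕ → Time T × E → ℂ := fun n p => ((n : ℂ) + 1) *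
      (φ (σ (A p.1 + 1 / ((n : ℝ) + 1))) p.2 - φ p.1 p.2) with hD
  have hDm : ∀ n, StronglyMeasurable (D n) := by
    intro n
    refine Measurable.stronglyMeasurable (measurable_const.mul (Measurable.sub ?_ ?_))
    · exact hφ.comp ((hσm.comp ((hA.measurable.comp measurable_fst).add_const _)).prodMk
        measurable_snd)
    · exact hφ
  refine ⟨fun t z => limUnder atTop (fun n => D n (t, z)), ?_, fun z hz => ?_⟩
  · exact (StronglyMeasurable.limUnder (l := atTop) hDm).measurable
  · obtain ⟨ψ, hψ⟩ := h z hz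
    have hae : (fun t => limUnder atTop (fun n => D n (t, z))) =ᵐ[dMeas A] ψ := by
      filter_upwards [ae_tendsto_of_isDensity hA hm hσ hψ] with t ht
      exact ht.limUnder_eq
    refine ⟨hψ.1.congr hae.symm, fun t => ?_⟩
    rw [integral_congr_ae (ae_restrict_of_ae hae)]
    exact hψ.2 t

theorem measurable_jointDensity (A : Time T → ℝ) (G : Set (ℂ × ℂ)) (φ : Time T → ℂ × ℂ → ℂ) :
    Measurable (Function.uncurry (jointDensity A G φ)) := by
  classical
  rw [jointDensity]
  split_ifs with h
  · exact h.choose_spec.1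
  · exact measurable_const

theorem isDensity_jointDensity (hA : Continuous A) (hm : StrictMono A) {G : Set (ℂ × ℂ)}
    {φ χ : Time T → ℂ × ℂ → ℂ} (hχ : Measurable (Function.uncurry χ))
    (heq : ∀ t, ∀ z ∈ G, φ t z = χ t z)
    (h : ∀ z ∈ G, AbsCont A (fun t => φ t z)) {z : ℂ × ℂ} (hz : z ∈ G) :
    IsDensity A (fun t => φ t z) (fun t => jointDensity A G φ t z) := by
  have he : ∀ z ∈ G, (fun t => φ t z) = fun t => χ t z := fun z hz => funext fun t => heq t z hz
  obtain ⟨ψ, hψm, hψ⟩ := exists_measurable_density hA hm (G := G) hχ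
    (fun z hz => by rw [← he z hz]; exact h z hz)
  have hex : ∃ ψ : Time T → ℂ × ℂ → ℂ, Measurable (Function.uncurry ψ) ∧
      ∀ z ∈ G, IsDensity A (fun t => φ t z) (fun t => ψ t z) :=
    ⟨ψ, hψm, fun z hz => by rw [he z hz]; exact hψ z hz⟩
  rw [jointDensity, dif_pos hex]
  exact hex.choose_spec.2 z hz

end JointDensity

/-! ### Exponentials of pairs -/

/-- `exp (z₁ y₁ + z₂ y₂)` for a complex pair `z` and a real pair `y`. -/
def expPair (z : ℂ × ℂ) (y : ℝ × ℝ) : ℂ := Complex.exp (z.1 * y.1 + z.2 * y.2)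

/-- `exp (r₁ y₁ + r₂ y₂)` for real pairs. -/
def rexpPair (r y : ℝ × ℝ) : ℝ := Real.exp (r.1 * y.1 + r.2 * y.2)

/-- The bijection `(y₁, y₂) ↦ (exp y₁, exp y₂)` onto the open quadrant. -/
def qexp (y : ℝ × ℝ) : Quadrant := ⟨(Real.exp y.1, Real.exp y.2), Real.exp_pos _, Real.exp_pos _⟩

theorem norm_expPair (z : ℂ × ℂ) (y : ℝ × ℝ) : ‖expPair z y‖ = rexpPair (re2 z) y := by
  simp [expPair, rexpPair, re2, Complex.norm_exp]

theorem enorm_expPair (z : ℂ × ℂ) (y : ℝ × ℝ) :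
    ‖expPair z y‖ₑ = ENNReal.ofReal (rexpPair (re2 z) y) := by
  rw [← ofReal_norm, norm_expPair]

theorem rexpPair_pos (r y : ℝ × ℝ) : 0 < rexpPair r y := Real.exp_pos _

theorem expPair_add (z : ℂ × ℂ) (x y : ℝ × ℝ) :
    expPair z (x + y) = expPair z x * expPair z y := by
  simp only [expPair, ← Complex.exp_add, Prod.fst_add, Prod.snd_add]
  push_cast
  ring_nf

theorem rexpPair_add (r x y : ℝ × ℝ) : rexpPair r (x + y) = rexpPair r x * rexpPair r y := by
  simp only [rexpPair, ← Real.exp_add, Prod.fst_add, Prod.snd_add]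
  ring_nf

@[simp] theorem expPair_zero (z : ℂ × ℂ) : expPair z 0 = 1 := by simp [expPair]

theorem cpow2_qexp (y : ℝ × ℝ) (z : ℂ × ℂ) : cpow2 (qexp y) z = expPair z y := by
  simp only [cpow2, qexp, expPair, Complex.exp_add]
  rw [Complex.ofReal_exp, Complex.ofReal_exp, Complex.cpow_def_of_ne_zero (Complex.exp_ne_zero _),
    Complex.cpow_def_of_ne_zero (Complex.exp_ne_zero _), ← Complex.ofReal_exp, ← Complex.ofReal_exp,
    ← Complex.ofReal_log (Real.exp_pos _).le, ← Complex.ofReal_log (Real.exp_pos _).le,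
    Real.log_exp, Real.log_exp, mul_comm z.1, mul_comm z.2]

theorem rpow2_qexp (y r : ℝ × ℝ) : rpow2 (qexp y) r = rexpPair r y := by
  simp only [rpow2, qexp, rexpPair, Real.exp_add]
  rw [← Real.exp_mul, ← Real.exp_mul, mul_comm r.1, mul_comm r.2]

theorem continuous_qexp : Continuous qexp :=
  Continuous.subtype_mk (by fun_prop) _

/-- The inverse of `qexp`. -/
def qlog (p : Quadrant) : ℝ × ℝ := (Real.log p.1.1, Real.log p.1.2)

theorem qexp_qlog (p : Quadrant) : qexp (qlog p) = p := by
  ext <;> simp [qexp, qlog, Real.exp_log p.2.1, Real.exp_log p.2.2]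

theorem continuous_qlog : Continuous qlog := by
  refine Continuous.prodMk ?_ ?_
  · exact Continuous.log (continuous_fst.comp continuous_subtype_val) fun p => p.2.1.ne'
  · exact Continuous.log (continuous_snd.comp continuous_subtype_val) fun p => p.2.2.ne'

theorem continuous_expPair : Continuous (fun p : (ℂ × ℂ) × (ℝ × ℝ) => expPair p.1 p.2) := by
  unfold expPair; fun_prop

theorem continuous_expPair_right (z : ℂ × ℂ) : Continuous (expPair z) := by
  unfold expPair; fun_prop

theorem continuous_rexpPair_right (r : ℝ × ℝ) : Continuous (rexpPair r) := by
  unfold rexpPair; fun_prop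

theorem abs_fst_snd_le (r : ℝ × ℝ) : |r.1| ≤ ‖r‖ ∧ |r.2| ≤ ‖r‖ :=
  ⟨norm_fst_le r, norm_snd_le r⟩

theorem abs_pairing_le {r y : ℝ × ℝ} {R N : ℝ} (hr : ‖r‖ ≤ R) (hy : ‖y‖ ≤ N) :
    |r.1 * y.1 + r.2 * y.2| ≤ 2 * R * N := by
  obtain ⟨r1, r2⟩ := abs_fst_snd_le r
  obtain ⟨y1, y2⟩ := abs_fst_snd_le y
  have h1 : |r.1 * y.1| ≤ R * N := by
    rw [abs_mul]
    exact mul_le_mul (r1.trans hr) (y1.trans hy) (abs_nonneg _) ((norm_nonneg _).trans hr)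
  have h2 : |r.2 * y.2| ≤ R * N := by
    rw [abs_mul]
    exact mul_le_mul (r2.trans hr) (y2.trans hy) (abs_nonneg _) ((norm_nonneg _).trans hr)
  linarith [abs_add_le (r.1 * y.1) (r.2 * y.2)]

theorem le_rexpPair {r y : ℝ × ℝ} {R N : ℝ} (hr : ‖r‖ ≤ R) (hy : ‖y‖ ≤ N) :
    Real.exp (-(2 * R * N)) ≤ rexpPair r y :=
  Real.exp_le_exp.2 (abs_le.1 (abs_pairing_le hr hy)).1

theorem rexpPair_le {r y : ℝ × ℝ} {R N : ℝ} (hr : ‖r‖ ≤ R) (hy : ‖y‖ ≤ N) :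
    rexpPair r y ≤ Real.exp (2 * R * N) :=
  Real.exp_le_exp.2 (abs_le.1 (abs_pairing_le hr hy)).2

/-! ### Càdlàg paths -/

theorem IsCadlag.exists_norm_le {E : Type*} [SeminormedAddCommGroup E] {y : Time T → E}
    (hy : IsCadlag y) : ∃ N : ℝ, ∀ t, ‖y t‖ ≤ N := by
  have h := isCompact_univ.induction_on (X := Time T) (p := fun s => ∃ N : ℝ, ∀ t ∈ s, ‖y t‖ ≤ N)
    ⟨0, by simp⟩ (fun s t hst ⟨N, hN⟩ => ⟨N, fun u hu => hN u (hst hu)⟩)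
    (fun s t ⟨N, hN⟩ ⟨M, hM⟩ => ⟨max N M, fun u hu => hu.elim
      (fun h => (hN u h).trans (le_max_left _ _)) fun h => (hM u h).trans (le_max_right _ _)⟩) ?_
  · obtain ⟨N, hN⟩ := h
    exact ⟨N, fun t => hN t trivial⟩
  · intro x _
    obtain ⟨hr, l, hl⟩ := hy x
    have h1 : ∀ᶠ u in 𝓝[≥] x, ‖y u‖ ≤ ‖y x‖ + 1 :=
      (hr.norm.eventually_lt_const (lt_add_one _)).mono fun _ h => h.le
    have h2 : ∀ᶠ u in 𝓝[<] x, ‖y u‖ ≤ ‖l‖ + 1 :=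
      (hl.norm.eventually_lt_const (lt_add_one _)).mono fun _ h => h.le
    refine ⟨{u | ‖y u‖ ≤ max (‖y x‖ + 1) (‖l‖ + 1)}, ?_, _, fun u hu => hu⟩
    rw [nhdsWithin_univ, ← nhdsLT_sup_nhdsGE]
    exact ⟨h2.mono fun u hu => hu.trans (le_max_right _ _),
      h1.mono fun u hu => hu.trans (le_max_left _ _)⟩

/-! ### Moments of the increments of an additive process -/

section Additive

variable [Fact ((0 : ℝ) ≤ T)] {Ω : Type*} {mΩ : MeasurableSpace Ω} {F : Filtration (Time T) mΩ}
  {P : Measure Ω} {Z : Time T → Ω → ℝ × ℝ}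

/-- `E[exp (r · (Z_t - Z_s))]`. -/
def incMoment (P : Measure Ω) (Z : Time T → Ω → ℝ × ℝ) (r : ℝ × ℝ) (s t : Time T) : ℝ≥0∞ :=
  ∫⁻ ω, ENNReal.ofReal (rexpPair r (Z t ω - Z s ω)) ∂P

theorem IsAdditiveProcess.measurable (hZ : IsAdditiveProcess F P Z) (t : Time T) :
    Measurable (Z t) := (hZ.adapted t).mono (F.le t) le_rfl

theorem IsAdditiveProcess.measurable_sub (hZ : IsAdditiveProcess F P Z) (s t : Time T) :
    Measurable (fun ω => Z t ω - Z s ω) := (hZ.measurable t).sub (hZ.measurable s)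

theorem IsAdditiveProcess.comap_le (hZ : IsAdditiveProcess F P Z) (s t : Time T) :
    MeasurableSpace.comap (fun ω => Z t ω - Z s ω) inferInstance ≤ mΩ :=
  (hZ.measurable_sub s t).comap_le

theorem IsAdditiveProcess.adapted_le (hZ : IsAdditiveProcess F P Z) {s t : Time T} (h : s ≤ t) :
    Measurable[F t] (Z s) := (hZ.adapted s).mono (F.mono h) le_rfl

theorem IsAdditiveProcess.lintegral_mul (hZ : IsAdditiveProcess F P Z) {s t : Time T} (h : s ≤ t)
    {X : Ω → ℝ≥0∞} (hX : Measurable[F s] X) {f : ℝ × ℝ → ℝ≥0∞} (hf : Measurable f) :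
    ∫⁻ ω, X ω * f (Z t ω - Z s ω) ∂P = (∫⁻ ω, X ω ∂P) * ∫⁻ ω, f (Z t ω - Z s ω) ∂P :=
  lintegral_mul_eq_lintegral_mul_lintegral_of_independent_measurableSpace (F.le s)
    (hZ.comap_le s t) (hZ.indep_increments s t h).symm hX
    (hf.comp (comap_measurable _))

theorem IsAdditiveProcess.incMoment_mul (hZ : IsAdditiveProcess F P Z) (r : ℝ × ℝ)
    {u s t : Time T} (hus : u ≤ s) (hst : s ≤ t) :
    incMoment P Z r u t = incMoment P Z r u s * incMoment P Z r s t := by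
  rw [incMoment, incMoment, incMoment, ← hZ.lintegral_mul hst
    (X := fun ω => ENNReal.ofReal (rexpPair r (Z s ω - Z u ω)))
    (f := fun y => ENNReal.ofReal (rexpPair r y))]
  · refine lintegral_congr fun ω => ?_
    rw [← ENNReal.ofReal_mul (rexpPair_pos _ _).le, ← rexpPair_add]
    congr 2
    abel
  · exact ((continuous_rexpPair_right r).measurable.comp
      ((hZ.adapted s).sub (hZ.adapted_le hus))).ennreal_ofReal
  · exact (continuous_rexpPair_right r).measurable.ennreal_ofReal

theorem IsAdditiveProcess.incMoment_bot (hZ : IsAdditiveProcess F P Z) (r : ℝ × ℝ) (t : Time T) :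
    incMoment P Z r ⊥ t = ∫⁻ ω, ENNReal.ofReal (rexpPair r (Z t ω)) ∂P := by
  refine lintegral_congr_ae ?_
  filter_upwards [hZ.zero] with ω hω
  rw [hω, sub_zero]

theorem IsAdditiveProcess.exists_half_le (hZ : IsAdditiveProcess F P Z) [IsProbabilityMeasure P] :
    ∃ N : ℝ, ∀ s t, 2⁻¹ ≤ P {ω | ‖Z t ω - Z s ω‖ ≤ N} := by
  set B : ℕ → Set Ω := fun n => {ω | ∀ t, ‖Z t ω‖ ≤ n} with hB
  have hmono : Monotone B := fun n m hnm ω hω t => (hω t).trans (by exact_mod_cast hnm)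
  have hun : ⋃ n, B n = univ := by
    refine eq_univ_of_forall fun ω => ?_
    obtain ⟨N, hN⟩ := (hZ.cadlag ω).exists_norm_le
    obtain ⟨n, hn⟩ := exists_nat_ge N
    exact mem_iUnion.2 ⟨n, fun t => (hN t).trans hn⟩
  have h1 := hmono.measure_iUnion (μ := P)
  rw [hun, measure_univ] at h1
  have h2 : (2⁻¹ : ℝ≥0∞) < ⨆ n, P (B n) := by
    rw [← h1]; exact ENNReal.inv_lt_one.2 (by norm_num)
  obtain ⟨n, hn⟩ := lt_iSup_iff.1 h2
  refine ⟨n + n, fun s t => hn.le.trans (measure_mono fun ω hω => ?_)⟩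
  exact (norm_sub_le _ _).trans (add_le_add (hω t) (hω s))

theorem IsAdditiveProcess.exists_le_incMoment (hZ : IsAdditiveProcess F P Z)
    [IsProbabilityMeasure P] (R : ℝ) :
    ∃ c : ℝ, 0 < c ∧ ∀ r, ‖r‖ ≤ R → ∀ s t, ENNReal.ofReal c ≤ incMoment P Z r s t := by
  obtain ⟨N, hN⟩ := hZ.exists_half_le
  refine ⟨Real.exp (-(2 * R * N)) * 2⁻¹, by positivity, fun r hr s t => ?_⟩
  refine le_trans ?_ (mul_meas_ge_le_lintegral
    ((continuous_rexpPair_right r).measurable.comp (hZ.measurable_sub s t)).ennreal_ofReal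
    (ENNReal.ofReal (Real.exp (-(2 * R * N)))))
  rw [ENNReal.ofReal_mul (Real.exp_pos _).le]
  refine mul_le_mul' le_rfl ?_
  rw [ENNReal.ofReal_inv_of_pos two_pos, ENNReal.ofReal_ofNat]
  refine (hN s t).trans (measure_mono fun ω hω => ?_)
  exact ENNReal.ofReal_le_ofReal (le_rexpPair hr hω)

/-- The increments inherit the exponential moments of `Z_T`, uniformly for bounded exponents. -/
theorem IsAdditiveProcess.exists_incMoment_le (hZ : IsAdditiveProcess F P Z)
    [IsProbabilityMeasure P] (R : ℝ) :
    ∃ c : ℝ, 0 < c ∧ ∀ r, ‖r‖ ≤ R → ∀ s t, s ≤ t →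
      incMoment P Z r s t ≤ ENNReal.ofReal c * incMoment P Z r ⊥ ⊤ := by
  obtain ⟨c, hc, h⟩ := hZ.exists_le_incMoment R
  refine ⟨c⁻¹ * c⁻¹, by positivity, fun r hr s t hst => ?_⟩
  rw [hZ.incMoment_mul r bot_le (le_top : t ≤ ⊤), hZ.incMoment_mul r bot_le hst]
  have h0 : ENNReal.ofReal c ≠ 0 := by simpa using hc
  calc incMoment P Z r s t
      = ENNReal.ofReal (c⁻¹ * c⁻¹) *
          (ENNReal.ofReal c * incMoment P Z r s t * ENNReal.ofReal c) := by
        rw [mul_comm (ENNReal.ofReal c), mul_assoc, ← ENNReal.ofReal_mul hc.le, mul_left_comm,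
          ← ENNReal.ofReal_mul (by positivity)]
        have : c⁻¹ * c⁻¹ * (c * c) = 1 := by field_simp
        rw [this, ENNReal.ofReal_one, mul_one]
    _ ≤ _ := by
        gcongr
        · exact h r hr _ _
        · exact h r hr _ _

theorem mem_expDomain_iff (hZ : IsAdditiveProcess F P Z) {z : ℂ × ℂ} :
    z ∈ expDomain P Z ↔ incMoment P Z (re2 z) ⊥ ⊤ < ∞ := by
  rw [hZ.incMoment_bot]
  have e : (fun ω => rpow2 (expProc Z ⊤ ω) (re2 z)) = fun ω => rexpPair (re2 z) (Z ⊤ ω) :=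
    funext fun ω => rpow2_qexp _ _
  rw [expDomain, mem_ofPred_eq, e]
  have hm : AEStronglyMeasurable (fun ω => rexpPair (re2 z) (Z ⊤ ω)) P :=
    ((continuous_rexpPair_right _).measurable.comp (hZ.measurable ⊤)).aestronglyMeasurable
  rw [Integrable, and_iff_right hm,
    hasFiniteIntegral_iff_ofReal (ae_of_all _ fun ω => (rexpPair_pos _ _).le)]

theorem IsAdditiveProcess.incMoment_lt_top (hZ : IsAdditiveProcess F P Z) [IsProbabilityMeasure P]
    {z : ℂ × ℂ} (hz : z ∈ expDomain P Z) {s t : Time T} (hst : s ≤ t) :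
    incMoment P Z (re2 z) s t < ∞ := by
  obtain ⟨c, -, h⟩ := hZ.exists_incMoment_le ‖re2 z‖
  exact (h _ le_rfl s t hst).trans_lt
    (ENNReal.mul_lt_top ENNReal.ofReal_lt_top ((mem_expDomain_iff hZ).1 hz))

theorem IsAdditiveProcess.integrable_inc (hZ : IsAdditiveProcess F P Z) [IsProbabilityMeasure P]
    {z : ℂ × ℂ} (hz : z ∈ expDomain P Z) {s t : Time T} (hst : s ≤ t) :
    Integrable (fun ω => expPair z (Z t ω - Z s ω)) P := by
  refine ⟨((continuous_expPair_right z).measurable.comp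
    (hZ.measurable_sub s t)).aestronglyMeasurable, ?_⟩
  rw [hasFiniteIntegral_iff_enorm]
  simp_rw [enorm_expPair]
  exact hZ.incMoment_lt_top hz hst

theorem IsAdditiveProcess.integrable_exp (hZ : IsAdditiveProcess F P Z) [IsProbabilityMeasure P]
    {z : ℂ × ℂ} (hz : z ∈ expDomain P Z) (t : Time T) :
    Integrable (fun ω => expPair z (Z t ω)) P := by
  refine (hZ.integrable_inc hz (bot_le : ⊥ ≤ t)).congr ?_
  filter_upwards [hZ.zero] with ω hω
  rw [hω, sub_zero]

/-- The transform `E[exp (z · (Z_t - Z_s))]` of an increment. -/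
def incChar (P : Measure Ω) (Z : Time T → Ω → ℝ × ℝ) (s t : Time T) (z : ℂ × ℂ) : ℂ :=
  ∫ ω, expPair z (Z t ω - Z s ω) ∂P

theorem IsAdditiveProcess.incChar_bot (hZ : IsAdditiveProcess F P Z) (t : Time T) (z : ℂ × ℂ) :
    incChar P Z ⊥ t z = ∫ ω, expPair z (Z t ω) ∂P := by
  refine integral_congr_ae ?_
  filter_upwards [hZ.zero] with ω hω
  rw [hω, sub_zero]

theorem IsAdditiveProcess.integral_mul_inc (hZ : IsAdditiveProcess F P Z)
    {s t : Time T} (hst : s ≤ t) {X : Ω → ℂ} (hX : Measurable[F s] X) (z : ℂ × ℂ) :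
    ∫ ω, X ω * expPair z (Z t ω - Z s ω) ∂P = (∫ ω, X ω ∂P) * incChar P Z s t z := by
  have hm : Measurable (fun ω => expPair z (Z t ω - Z s ω)) :=
    (continuous_expPair_right z).measurable.comp (hZ.measurable_sub s t)
  refine IndepFun.integral_fun_mul_eq_mul_integral ?_
    (hX.mono (F.le s) le_rfl).aestronglyMeasurable hm.aestronglyMeasurable
  rw [IndepFun_iff_Indep]
  refine indep_of_indep_of_le_left (indep_of_indep_of_le_right
    (hZ.indep_increments s t hst).symm ?_) hX.comap_le
  exact ((continuous_expPair_right z).measurable.comp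
    (comap_measurable (fun ω => Z t ω - Z s ω))).comap_le

theorem IsAdditiveProcess.incChar_mul (hZ : IsAdditiveProcess F P Z) (z : ℂ × ℂ)
    {u s t : Time T} (hus : u ≤ s) (hst : s ≤ t) :
    incChar P Z u t z = incChar P Z u s z * incChar P Z s t z := by
  rw [incChar, incChar, ← hZ.integral_mul_inc hst (X := fun ω => expPair z (Z s ω - Z u ω))]
  · refine integral_congr_ae (ae_of_all _ fun ω => ?_)
    beta_reduce
    rw [← expPair_add]
    congr 1
    abel
  · exact (continuous_expPair_right z).measurable.comp ((hZ.adapted s).sub (hZ.adapted_le hus))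

omit [Fact ((0 : ℝ) ≤ T)] in
theorem enorm_incChar_le (s t : Time T) (z : ℂ × ℂ) :
    ‖incChar P Z s t z‖ₑ ≤ incMoment P Z (re2 z) s t := by
  refine (enorm_integral_le_lintegral_enorm _).trans (le_of_eq ?_)
  simp_rw [enorm_expPair]
  rfl

end Additive

section Additive

variable [Fact ((0 : ℝ) ≤ T)] {Ω : Type*} {mΩ : MeasurableSpace Ω} {F : Filtration (Time T) mΩ}
  {P : Measure Ω} {Z : Time T → Ω → ℝ × ℝ}

/-! ### Continuity of the transform -/

theorem IsAdditiveProcess.condExp_rexpPair (hZ : IsAdditiveProcess F P Z) [IsProbabilityMeasure P]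
    {z : ℂ × ℂ} (hz : z ∈ expDomain P Z) (u : Time T) :
    P[fun ω => rexpPair (re2 z) (Z ⊤ ω)|F u] =ᵐ[P] fun ω => rexpPair (re2 z) (Z u ω) *
      ∫ ω', rexpPair (re2 z) (Z ⊤ ω' - Z u ω') ∂P := by
  have hr : ∀ s t, s ≤ t → Integrable (fun ω => rexpPair (re2 z) (Z t ω - Z s ω)) P :=
    fun s t hst => (hZ.integrable_inc hz hst).norm.congr
      (ae_of_all _ fun ω => norm_expPair _ _)
  have hr' : Integrable (fun ω => rexpPair (re2 z) (Z ⊤ ω)) P :=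
    (hZ.integrable_exp hz ⊤).norm.congr (ae_of_all _ fun ω => norm_expPair _ _)
  have e : (fun ω => rexpPair (re2 z) (Z ⊤ ω)) = (fun ω => rexpPair (re2 z) (Z u ω)) *
      fun ω => rexpPair (re2 z) (Z ⊤ ω - Z u ω) := by
    funext ω
    rw [Pi.mul_apply, ← rexpPair_add, add_sub_cancel]
  rw [e] at hr' ⊢
  have h1 := condExp_mul_of_stronglyMeasurable_left (m := F u)
    ((continuous_rexpPair_right (re2 z)).measurable.comp (hZ.adapted u)).stronglyMeasurable
    hr' (hr u ⊤ le_top)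
  have h2 := condExp_indep_eq (hZ.comap_le u ⊤) (F.le u)
    ((continuous_rexpPair_right (re2 z)).measurable.comp
      (comap_measurable (fun ω => Z ⊤ ω - Z u ω))).stronglyMeasurable
    (hZ.indep_increments u ⊤ le_top)
  filter_upwards [h1, h2] with ω h1 h2
  refine h1.trans ?_
  rw [Pi.mul_apply]
  refine congrArg _ h2

theorem IsAdditiveProcess.unifIntegrable_exp (hZ : IsAdditiveProcess F P Z)
    [IsProbabilityMeasure P] {z : ℂ × ℂ} (hz : z ∈ expDomain P Z) :
    UnifIntegrable (fun u ω => expPair z (Z u ω)) 1 P := by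
  obtain ⟨c, hc, hcm⟩ := hZ.exists_le_incMoment ‖re2 z‖
  have hr' : Integrable (fun ω => rexpPair (re2 z) (Z ⊤ ω)) P :=
    (hZ.integrable_exp hz ⊤).norm.congr (ae_of_all _ fun ω => norm_expPair _ _)
  have hui := (hr'.uniformIntegrable_condExp_filtration (f := F)).2.1
  intro ε hε
  obtain ⟨δ, hδ, h⟩ := hui (ε := c * ε) (by positivity)
  refine ⟨δ, hδ, fun u s hs hμ => ?_⟩
  have h1 := h u s hs hμ
  have hle : ∀ᵐ ω ∂P, ‖s.indicator (fun ω => expPair z (Z u ω)) ω‖ ≤ c⁻¹ *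
      ‖s.indicator (P[fun ω => rexpPair (re2 z) (Z ⊤ ω)|F u]) ω‖ := by
    filter_upwards [hZ.condExp_rexpPair hz u] with ω hω
    by_cases hs : ω ∈ s
    · have hM : c ≤ ∫ ω', rexpPair (re2 z) (Z ⊤ ω' - Z u ω') ∂P := by
        rw [integral_eq_lintegral_of_nonneg_ae (ae_of_all _ fun ω => (rexpPair_pos _ _).le)
          ((continuous_rexpPair_right _).measurable.comp
            (hZ.measurable_sub u ⊤)).aestronglyMeasurable]
        exact (ENNReal.ofReal_le_iff_le_toReal (hZ.incMoment_lt_top hz le_top).ne).1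
          (hcm _ le_rfl u ⊤)
      rw [indicator_of_mem hs, indicator_of_mem hs, hω, norm_expPair, norm_mul,
        Real.norm_of_nonneg (rexpPair_pos _ _).le, Real.norm_of_nonneg (hc.le.trans hM)]
      rw [← mul_assoc, mul_comm c⁻¹, mul_assoc]
      refine le_mul_of_one_le_right (rexpPair_pos _ _).le ?_
      rw [inv_mul_eq_div, one_le_div hc]
      exact hM
    · simp [hs]
  refine (eLpNorm_le_mul_eLpNorm_of_ae_le_mul hle 1).trans ?_
  refine (mul_le_mul' le_rfl h1).trans (le_of_eq ?_)
  rw [← ENNReal.ofReal_mul (by positivity), inv_mul_cancel_left₀ hc.ne']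

theorem IsAdditiveProcess.tendsto_lintegral_exp_sub (hZ : IsAdditiveProcess F P Z)
    [IsProbabilityMeasure P] {z : ℂ × ℂ} (hz : z ∈ expDomain P Z) (t : Time T) :
    Tendsto (fun u => ∫⁻ ω, ‖expPair z (Z u ω) - expPair z (Z t ω)‖ₑ ∂P) (𝓝 t) (𝓝 0) := by
  refine tendsto_of_seq_tendsto fun u hu => tendsto_of_subseq_tendsto fun ns hns => ?_
  obtain ⟨ms, hms, hae⟩ := (((hZ.continuous_in_probability t).comp
    (hu.comp hns))).exists_seq_tendsto_ae
  refine ⟨ms, ?_⟩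
  have hlim := tendsto_Lp_finite_of_tendsto_ae (μ := P) (p := 1)
    (f := fun n ω => expPair z (Z (u (ns (ms n))) ω)) (g := fun ω => expPair z (Z t ω))
    le_rfl ENNReal.one_ne_top (fun n => (hZ.integrable_exp hz _).aestronglyMeasurable)
    (memLp_one_iff_integrable.2 (hZ.integrable_exp hz t)) ?_ ?_
  · simp only [eLpNorm_one_eq_lintegral_enorm, Pi.sub_apply] at hlim
    exact hlim
  · intro ε hε
    obtain ⟨δ, hδ, h⟩ := hZ.unifIntegrable_exp hz hε
    exact ⟨δ, hδ, fun n => h _⟩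
  · filter_upwards [hae] with ω hω
    exact ((continuous_expPair_right z).tendsto _).comp hω

theorem IsAdditiveProcess.continuous_incChar (hZ : IsAdditiveProcess F P Z)
    [IsProbabilityMeasure P] {z : ℂ × ℂ} (hz : z ∈ expDomain P Z) :
    Continuous (fun t => incChar P Z ⊥ t z) := by
  simp_rw [hZ.incChar_bot]
  refine continuous_iff_continuousAt.2 fun t => ?_
  exact tendsto_integral_of_L1 _ (hZ.integrable_exp hz t).aestronglyMeasurable
    (Eventually.of_forall fun u => hZ.integrable_exp hz u) (hZ.tendsto_lintegral_exp_sub hz t)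

theorem IsAdditiveProcess.incChar_self (_ : IsAdditiveProcess F P Z) [IsProbabilityMeasure P]
    (t : Time T) (z : ℂ × ℂ) : incChar P Z t t z = 1 := by
  simp [incChar]

theorem IsAdditiveProcess.incChar_ne_zero (hZ : IsAdditiveProcess F P Z)
    [IsProbabilityMeasure P] {z : ℂ × ℂ} (hz : z ∈ expDomain P Z) (t : Time T) :
    incChar P Z ⊥ t z ≠ 0 := by
  intro h0
  have hcl : IsClosed {t : Time T | incChar P Z ⊥ t z = 0} :=
    isClosed_eq (hZ.continuous_incChar hz) continuous_const
  obtain ⟨v, hv, hmin⟩ := hcl.isCompact.exists_isLeast ⟨t, h0⟩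
  have hvb : ⊥ < v := by
    rw [bot_lt_iff_ne_bot]
    rintro rfl
    have : incChar P Z ⊥ ⊥ z = 0 := hv
    rw [hZ.incChar_self] at this
    exact one_ne_zero this
  obtain ⟨c, hc, hcm⟩ := hZ.exists_le_incMoment ‖re2 z‖
  have hge : ∀ u < v, ENNReal.ofReal c ≤ ∫⁻ ω, ‖expPair z (Z u ω) - expPair z (Z v ω)‖ₑ ∂P := by
    intro u hu
    have hu0 : incChar P Z ⊥ u z ≠ 0 := fun h => (hmin h).not_gt hu
    have huv : incChar P Z u v z = 0 := by
      have := hZ.incChar_mul z bot_le hu.le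
      rw [show incChar P Z ⊥ v z = 0 from hv] at this
      exact (mul_eq_zero.1 this.symm).resolve_left hu0
    have h1 : (1 : ℝ≥0∞) ≤ ∫⁻ ω, ‖1 - expPair z (Z v ω - Z u ω)‖ₑ ∂P := by
      have e : ∫ ω, (1 - expPair z (Z v ω - Z u ω)) ∂P = 1 := by
        rw [integral_sub (integrable_const _) (hZ.integrable_inc hz hu.le)]
        rw [incChar] at huv
        simp [huv]
      calc (1 : ℝ≥0∞) = ‖∫ ω, (1 - expPair z (Z v ω - Z u ω)) ∂P‖ₑ := by rw [e]; simp
        _ ≤ _ := enorm_integral_le_lintegral_enorm _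
    have h2 : ∫⁻ ω, ‖expPair z (Z u ω) - expPair z (Z v ω)‖ₑ ∂P
        = incMoment P Z (re2 z) ⊥ u * ∫⁻ ω, ‖1 - expPair z (Z v ω - Z u ω)‖ₑ ∂P := by
      rw [hZ.incMoment_bot, ← hZ.lintegral_mul hu.le
        (X := fun ω => ENNReal.ofReal (rexpPair (re2 z) (Z u ω)))
        (f := fun y => ‖1 - expPair z y‖ₑ)]
      · refine lintegral_congr fun ω => ?_
        rw [← enorm_expPair, ← enorm_mul, mul_sub, mul_one, ← expPair_add, add_sub_cancel]
      · exact ((continuous_rexpPair_right _).measurable.comp (hZ.adapted u)).ennreal_ofReal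
      · exact (measurable_const.sub (continuous_expPair_right z).measurable).enorm
    rw [h2]
    calc ENNReal.ofReal c = ENNReal.ofReal c * 1 := (mul_one _).symm
      _ ≤ _ := mul_le_mul' (hcm _ le_rfl _ _) h1
  have hne : (𝓝[<] v).NeBot := nhdsLT_neBot_of_exists_lt ⟨⊥, hvb⟩
  have hlim := (hZ.tendsto_lintegral_exp_sub hz v).mono_left (nhdsWithin_le_nhds (s := Iio v))
  have hle := ge_of_tendsto hlim (eventually_mem_nhdsWithin.mono fun u hu => hge u hu)
  simp only [nonpos_iff_eq_zero, ENNReal.ofReal_eq_zero] at hle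
  exact hle.not_gt hc

theorem IsAdditiveProcess.measurable_incChar (hZ : IsAdditiveProcess F P Z) [SFinite P]
    (s t : Time T) : Measurable (incChar P Z s t) := by
  have h : StronglyMeasurable (Function.uncurry fun (z : ℂ × ℂ) ω => expPair z (Z t ω - Z s ω)) :=
    (continuous_expPair.measurable.comp
      (measurable_fst.prodMk ((hZ.measurable_sub s t).comp measurable_snd))).stronglyMeasurable
  exact h.integral_prod_right.measurable

end Additive

/-! ### Continuous logarithms -/

section Logarithm

variable [Fact ((0 : ℝ) ≤ T)]

/-- The points of the uniform partition of `[0,T]` into `n + 1` intervals. -/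
def partPoint (n k : ℕ) : Time T := projIcc 0 T Fact.out (k * (T / (n + 1)))

/-- Approximation of the continuous logarithm of `φ` along the uniform partition. -/
def logSum (φ : Time T → ℂ) (n : ℕ) (t : Time T) : ℂ :=
  ∑ k ∈ Finset.range (n + 1),
    Complex.log (φ (min t (partPoint n (k + 1))) / φ (min t (partPoint n k)))

theorem partPoint_zero (n : ℕ) : (partPoint n 0 : Time T) = ⊥ := by
  rw [partPoint, Nat.cast_zero, zero_mul]
  exact projIcc_of_le_left (Fact.out : (0 : ℝ) ≤ T) le_rfl

theorem partPoint_last (n : ℕ) : (partPoint n (n + 1) : Time T) = ⊤ := by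
  have : ((n + 1 : ℕ) : ℝ) * (T / (n + 1)) = T := by
    push_cast
    field_simp
  rw [partPoint, this]
  exact projIcc_of_right_le (Fact.out : (0 : ℝ) ≤ T) le_rfl

theorem dist_partPoint_le (n k : ℕ) (t : Time T) :
    dist (min t (partPoint n (k + 1))) (min t (partPoint n k)) ≤ T / (n + 1) := by
  have hT : 0 ≤ T := Fact.out
  have h0 : 0 ≤ T / ((n : ℝ) + 1) := by positivity
  have h1 : dist (partPoint n (k + 1) : Time T) (partPoint n k) ≤ T / (n + 1) := by
    rw [Subtype.dist_eq, Real.dist_eq]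
    refine (abs_projIcc_sub_projIcc (Fact.out : (0 : ℝ) ≤ T)).trans (le_of_eq ?_)
    push_cast
    rw [← sub_mul, add_sub_cancel_left, one_mul, abs_of_nonneg h0]
  refine le_trans ?_ h1
  rw [Subtype.dist_eq, Subtype.dist_eq, Real.dist_eq, Real.dist_eq]
  have hmin : ∀ a b : Time T, ((min a b : Time T) : ℝ) = min (a : ℝ) b := fun a b =>
    (Subtype.mono_coe (Icc (0 : ℝ) T)).map_min
  rw [hmin, hmin]
  refine (abs_min_sub_min_le_max _ _ _ _).trans ?_
  simp

theorem prod_range_div_of_ne_zero {K : Type*} [Field K] {a : ℕ → K} (h : ∀ n, a n ≠ 0) (n : ℕ) :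
    ∏ k ∈ Finset.range n, a (k + 1) / a k = a n / a 0 := by
  induction n with
  | zero => simp [h 0]
  | succ n ih => rw [Finset.prod_range_succ, ih]; field_simp [h n]

theorem eventually_logSum {φ : Time T → ℂ} (hφ : Continuous φ) (h0 : ∀ t, φ t ≠ 0)
    (hbot : φ ⊥ = 1) : ∀ᶠ n : ℕ in atTop, Continuous (logSum φ n) ∧ logSum φ n ⊥ = 0 ∧
      ∀ t, Complex.exp (logSum φ n t) = φ t := by
  obtain ⟨v, -, hv⟩ := isCompact_univ.exists_isMinOn (univ_nonempty (α := Time T))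
    hφ.norm.continuousOn
  have hm : 0 < ‖φ v‖ := norm_pos_iff.2 (h0 v)
  have huc := Metric.uniformContinuous_iff.1 (CompactSpace.uniformContinuous_of_continuous hφ)
  obtain ⟨δ, hδ, hd⟩ := huc ‖φ v‖ hm
  have hlim : Tendsto (fun n : ℕ => T / ((n : ℝ) + 1)) atTop (𝓝 0) := by
    simpa [div_eq_mul_inv] using (tendsto_one_div_add_atTop_nhds_zero_nat (𝕜 := ℝ)).const_mul T
  filter_upwards [hlim.eventually_lt_const hδ] with n hn
  have hslit : ∀ k t, φ (min t (partPoint n (k + 1))) / φ (min t (partPoint n k))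
      ∈ Complex.slitPlane := by
    intro k t
    have h1 := hd ((dist_partPoint_le n k t).trans_lt hn)
    set a := φ (min t (partPoint n (k + 1)))
    set b := φ (min t (partPoint n k)) with hb
    have hb0 : b ≠ 0 := h0 _
    refine Complex.mem_slitPlane_of_norm_lt_one (z := a / b - 1) ?_ |> fun h => by simpa using h
    rw [div_sub_one hb0, norm_div, div_lt_one (norm_pos_iff.2 hb0), ← dist_eq_norm]
    exact h1.trans_le (hv (mem_univ (min t (partPoint n k))))
  refine ⟨?_, ?_, fun t => ?_⟩
  · refine continuous_finsetSum _ fun k _ => continuous_iff_continuousAt.2 fun t => ?_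
    refine ContinuousAt.clog (f := fun t => φ (min t (partPoint n (k + 1)))
      / φ (min t (partPoint n k))) ?_ (hslit k t)
    exact ((hφ.comp (continuous_id.min continuous_const)).div
      (hφ.comp (continuous_id.min continuous_const)) fun t => h0 _).continuousAt
  · refine Finset.sum_eq_zero fun k _ => ?_
    simp [hbot]
  · rw [logSum, Complex.exp_sum]
    have h2 : ∀ k ∈ Finset.range (n + 1), Complex.exp (Complex.log
        (φ (min t (partPoint n (k + 1))) / φ (min t (partPoint n k))))
        = φ (min t (partPoint n (k + 1))) / φ (min t (partPoint n k)) := fun k _ =>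
      Complex.exp_log (div_ne_zero (h0 _) (h0 _))
    rw [Finset.prod_congr rfl h2,
      prod_range_div_of_ne_zero (a := fun k => φ (min t (partPoint n k))) fun k => h0 _, partPoint_last, partPoint_zero]
    simp [hbot]

omit [Fact ((0 : ℝ) ≤ T)] in
theorem eq_of_exp_eq [PreconnectedSpace (Time T)] {c d : Time T → ℂ} (hc : Continuous c)
    (hd : Continuous d) (t₀ : Time T)
    (h0 : c t₀ = d t₀) (h : ∀ t, Complex.exp (c t) = Complex.exp (d t)) : c = d :=
  Complex.isCoveringMap_exp.eq_of_comp_eq hc hd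
    (funext fun t => Subtype.ext (h t)) t₀ h0

end Logarithm

/-! ### The generating function -/

section GenFun

variable [Fact ((0 : ℝ) ≤ T)] {Ω : Type*} {mΩ : MeasurableSpace Ω} {F : Filtration (Time T) mΩ}
  {P : Measure Ω} {Z : Time T → Ω → ℝ × ℝ}

theorem continuous_genFun (z : ℂ × ℂ) : Continuous (fun t => genFun P Z t z) := by
  classical
  by_cases h : ∃ c : Time T → ℂ, Continuous c ∧ c ⊥ = 0 ∧
        ∀ s, Complex.exp (c s) = ∫ ω, cpow2 (expProc Z s ω) z ∂P
  · simp only [genFun, dif_pos h]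
    exact h.choose_spec.1
  · simp only [genFun, dif_neg h]
    exact continuous_const

theorem continuous_rhoS : Continuous (rhoS P Z) :=
  Complex.continuous_re.comp
    ((continuous_genFun _).sub (continuous_const.mul (continuous_genFun _)))

theorem IsAdditiveProcess.genFun_spec (hZ : IsAdditiveProcess F P Z) [IsProbabilityMeasure P]
    {z : ℂ × ℂ} (hz : z ∈ expDomain P Z) : genFun P Z ⊥ z = 0 ∧
      ∀ t, Complex.exp (genFun P Z t z) = incChar P Z ⊥ t z := by
  have he : ∀ t, incChar P Z ⊥ t z = ∫ ω, cpow2 (expProc Z t ω) z ∂P := by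
    intro t
    rw [hZ.incChar_bot]
    exact integral_congr_ae (ae_of_all _ fun ω => (cpow2_qexp _ _).symm)
  obtain ⟨n, hn1, hn2, hn3⟩ := (eventually_logSum (hZ.continuous_incChar hz)
    (hZ.incChar_ne_zero hz) (hZ.incChar_self ⊥ z)).exists
  have h : ∃ c : Time T → ℂ, Continuous c ∧ c ⊥ = 0 ∧
      ∀ s, Complex.exp (c s) = ∫ ω, cpow2 (expProc Z s ω) z ∂P :=
    ⟨_, hn1, hn2, fun s => by rw [hn3, he]⟩
  simp only [genFun, dif_pos h]
  exact ⟨h.choose_spec.2.1, fun t => by rw [h.choose_spec.2.2 t, he]⟩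

theorem IsAdditiveProcess.exp_genFun_sub (hZ : IsAdditiveProcess F P Z) [IsProbabilityMeasure P]
    {z : ℂ × ℂ} (hz : z ∈ expDomain P Z) {s t : Time T} (hst : s ≤ t) :
    Complex.exp (genFun P Z t z - genFun P Z s z) = incChar P Z s t z := by
  rw [Complex.exp_sub, (hZ.genFun_spec hz).2, (hZ.genFun_spec hz).2,
    hZ.incChar_mul z bot_le hst, mul_div_cancel_left₀ _ (hZ.incChar_ne_zero hz s)]

theorem IsAdditiveProcess.measurable_indicator_genFun (hZ : IsAdditiveProcess F P Z)
    [IsProbabilityMeasure P] {G : Set (ℂ × ℂ)} (hG : MeasurableSet G) (hGD : G ⊆ expDomain P Z)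
    (t : Time T) : Measurable (G.indicator (genFun P Z t)) := by
  refine measurable_of_tendsto_metrizable
    (f := fun n => G.indicator fun z => logSum (fun s => incChar P Z ⊥ s z) n t) (fun n => ?_) ?_
  · refine Measurable.indicator ?_ hG
    exact Finset.measurable_fun_sum _ fun k _ => Complex.measurable_log.comp
      ((hZ.measurable_incChar _ _).div (hZ.measurable_incChar _ _))
  · refine tendsto_pi_nhds.2 fun z => ?_
    by_cases hz : z ∈ G
    swap
    · simp [hz]
    simp only [indicator_of_mem hz]
    have : PreconnectedSpace (Time T) := isPreconnected_iff_preconnectedSpace.1 isPreconnected_Icc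
    obtain ⟨h1, h2⟩ := hZ.genFun_spec (hGD hz)
    refine tendsto_const_nhds.congr' ?_
    filter_upwards [eventually_logSum (hZ.continuous_incChar (hGD hz))
      (hZ.incChar_ne_zero (hGD hz)) (hZ.incChar_self ⊥ z)] with n ⟨hn1, hn2, hn3⟩
    exact congrFun (eq_of_exp_eq (continuous_genFun z) hn1 ⊥ (h1.trans hn2.symm)
      fun s => (h2 s).trans (hn3 s).symm) t

theorem IsAdditiveProcess.measurable_uncurry_indicator_genFun (hZ : IsAdditiveProcess F P Z)
    [IsProbabilityMeasure P] {G : Set (ℂ × ℂ)} (hG : MeasurableSet G)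
    (hGD : G ⊆ expDomain P Z) :
    Measurable (Function.uncurry fun t => G.indicator (genFun P Z t)) := by
  refine measurable_uncurry_of_continuous_of_measurable (fun z => ?_)
    (hZ.measurable_indicator_genFun hG hGD)
  by_cases hz : z ∈ G
  · simpa [hz] using continuous_genFun (P := P) (Z := Z) z
  · simpa [hz] using continuous_const

end GenFun

/-! ### Left limits -/

section LeftLimit

variable [Fact ((0 : ℝ) ≤ T)] {Ω : Type*} {mΩ : MeasurableSpace Ω} {F : Filtration (Time T) mΩ}
  {P : Measure Ω} {Z : Time T → Ω → ℝ × ℝ}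

omit [Fact ((0 : ℝ) ≤ T)] in
theorem IsCadlag.tendsto_leftLim {E : Type*} [TopologicalSpace E] [T2Space E] {y : Time T → E}
    (hy : IsCadlag y) (u : Time T) : Tendsto y (𝓝[<] u) (𝓝 (Function.leftLim y u)) := by
  obtain ⟨l, hl⟩ := (hy u).2
  by_cases h : 𝓝[<] u = ⊥
  · rw [h]; exact tendsto_bot
  · have : (𝓝[<] u).NeBot := ⟨h⟩
    rwa [leftLim_eq_of_tendsto hl]

omit [Fact ((0 : ℝ) ≤ T)] in
theorem IsCadlag.leftLim_comp {E E' : Type*} [TopologicalSpace E] [T2Space E]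
    [TopologicalSpace E'] [T2Space E'] {y : Time T → E}
    (hy : IsCadlag y) {f : E → E'} (hf : Continuous f) (u : Time T) :
    Function.leftLim (fun s => f (y s)) u = f (Function.leftLim y u) := by
  by_cases h : 𝓝[<] u = ⊥
  · rw [leftLim_eq_of_eq_bot _ h, leftLim_eq_of_eq_bot _ h]
  · have : (𝓝[<] u).NeBot := ⟨h⟩
    exact leftLim_eq_of_tendsto ((hf.tendsto _).comp (hy.tendsto_leftLim u))

omit [Fact ((0 : ℝ) ≤ T)] in
theorem IsCadlag.comp_continuous {E E' : Type*} [TopologicalSpace E]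
    [TopologicalSpace E'] {y : Time T → E}
    (hy : IsCadlag y) {f : E → E'} (hf : Continuous f) : IsCadlag (fun s => f (y s)) :=
  fun t => ⟨hf.continuousAt.comp_continuousWithinAt (hy t).1,
    (hy t).2.imp' f fun _ hl => (hf.tendsto _).comp hl⟩

theorem IsAdditiveProcess.leftLim_expProc (hZ : IsAdditiveProcess F P Z) (ω : Ω) (u : Time T) :
    Function.leftLim (fun s => expProc Z s ω) u = qexp (Function.leftLim (fun s => Z s ω) u) :=
  (hZ.cadlag ω).leftLim_comp continuous_qexp u

theorem IsAdditiveProcess.leftLim_ae_eq (hZ : IsAdditiveProcess F P Z) (u : Time T) :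
    ∀ᵐ ω ∂P, Function.leftLim (fun s => Z s ω) u = Z u ω := by
  by_cases h : 𝓝[<] u = ⊥
  · exact ae_of_all _ fun ω => leftLim_eq_of_eq_bot _ h
  · have : (𝓝[<] u).NeBot := ⟨h⟩
    have hm : TendstoInMeasure P Z (𝓝[<] u) (Z u) := fun ε hε =>
      (hZ.continuous_in_probability u ε hε).mono_left nhdsWithin_le_nhds
    obtain ⟨ns, hns, hae⟩ := hm.exists_seq_tendsto_ae'
    filter_upwards [hae] with ω hω
    exact tendsto_nhds_unique (((hZ.cadlag ω).tendsto_leftLim u).comp hns) hω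

/-- The last point of a grid of mesh `1 / (n + 1)` strictly before `v` (and `⊥` if `v = ⊥`). -/
def gridBefore (n : ℕ) (v : Time T) : Time T :=
  projIcc 0 T Fact.out (((⌈(v : ℝ) * (n + 1)⌉₊ - 1 : ℕ) : ℝ) / (n + 1))

theorem gridBefore_bot (n : ℕ) : gridBefore n (⊥ : Time T) = ⊥ := by
  have h : ((⊥ : Time T) : ℝ) = 0 := rfl
  rw [gridBefore, h]
  simp only [zero_mul, Nat.ceil_zero, Nat.zero_sub, Nat.cast_zero, zero_div]
  exact projIcc_of_le_left (Fact.out : (0 : ℝ) ≤ T) le_rfl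

theorem gridBefore_spec (n : ℕ) {v : Time T} (hv : ⊥ < v) :
    gridBefore n v < v ∧ (v : ℝ) - 1 / (n + 1) ≤ gridBefore n v := by
  have hv0 : (0 : ℝ) < v := hv
  have hn : (0 : ℝ) < (n : ℝ) + 1 := by positivity
  have hpos : 0 < (v : ℝ) * (n + 1) := by positivity
  set k := ⌈(v : ℝ) * (n + 1)⌉₊ with hk
  have hk1 : 1 ≤ k := Nat.ceil_pos.2 hpos
  have hlt : ((k - 1 : ℕ) : ℝ) < (v : ℝ) * (n + 1) := by
    have := Nat.ceil_lt_add_one hpos.le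
    rw [Nat.cast_sub hk1, Nat.cast_one]
    linarith
  have hge : (v : ℝ) * (n + 1) - 1 ≤ ((k - 1 : ℕ) : ℝ) := by
    have := Nat.le_ceil ((v : ℝ) * (n + 1))
    rw [Nat.cast_sub hk1, Nat.cast_one]
    linarith
  have hq : ((k - 1 : ℕ) : ℝ) / (n + 1) < v := by rwa [div_lt_iff₀ hn]
  have hmem : ((k - 1 : ℕ) : ℝ) / (n + 1) ∈ Icc (0 : ℝ) T :=
    ⟨by positivity, hq.le.trans v.2.2⟩
  have e : ((gridBefore n v : Time T) : ℝ) = ((k - 1 : ℕ) : ℝ) / (n + 1) := by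
    rw [gridBefore, projIcc_of_mem _ hmem]
  refine ⟨?_, ?_⟩
  · rw [← Subtype.coe_lt_coe, e]; exact hq
  · rw [e, le_div_iff₀ hn, sub_mul, one_div_mul_cancel hn.ne']
    exact hge

theorem gridBefore_le (n : ℕ) (v : Time T) : gridBefore n v ≤ v := by
  rcases eq_or_ne v ⊥ with rfl | h
  · rw [gridBefore_bot]
  · exact (gridBefore_spec n (bot_lt_iff_ne_bot.2 h)).1.le

theorem tendsto_gridBefore {v : Time T} (hv : ⊥ < v) :
    Tendsto (fun n => gridBefore n v) atTop (𝓝[<] v) := by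
  refine tendsto_nhdsWithin_iff.2 ⟨?_, Eventually.of_forall fun n => (gridBefore_spec n hv).1⟩
  rw [tendsto_subtype_rng]
  refine tendsto_of_tendsto_of_tendsto_of_le_of_le (g := fun n : ℕ => (v : ℝ) - 1 / (n + 1))
    (h := fun _ => (v : ℝ)) ?_ tendsto_const_nhds
    (fun n => (gridBefore_spec n hv).2) (fun n => (gridBefore_spec n hv).1.le)
  simpa using (tendsto_const_nhds (x := (v : ℝ))).sub
    (tendsto_one_div_add_atTop_nhds_zero_nat (𝕜 := ℝ))

/-- The left-limit process is progressively measurable. -/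
theorem IsAdditiveProcess.measurable_leftLim (hZ : IsAdditiveProcess F P Z) (t : Time T) :
    Measurable[(inferInstance : MeasurableSpace (Time T)).prod (F t)]
      (fun p : Time T × Ω => Function.leftLim (fun s => Z s p.2) (min p.1 t)) := by
  let _ : MeasurableSpace Ω := F t
  refine measurable_of_tendsto_metrizable
    (f := fun n (p : Time T × Ω) => Z (gridBefore n (min p.1 t)) p.2) (fun n => ?_) ?_
  · have h1 : Measurable (fun q : ℕ × Ω =>
        Z (min (projIcc 0 T Fact.out ((q.1 : ℝ) / (n + 1))) t) q.2) :=
      measurable_from_prod_countable_right fun k =>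
        hZ.adapted_le (min_le_right (projIcc 0 T Fact.out ((k : ℝ) / (n + 1))) t)
    have h2 : Measurable (fun p : Time T × Ω =>
        ((⌈((min p.1 t : Time T) : ℝ) * (n + 1)⌉₊ - 1 : ℕ), p.2)) := by
      refine Measurable.prodMk ?_ measurable_snd
      refine (measurable_of_countable fun k : ℕ => k - 1).comp (Nat.measurable_ceil.comp ?_)
      exact (measurable_subtype_coe.comp (measurable_fst.min measurable_const)).mul_const _
    convert h1.comp h2 using 1
    funext p
    have := (gridBefore_le n (min p.1 t)).trans (min_le_right _ _)
    exact congrArg (fun s => Z s p.2) (min_eq_left this).symm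
  · refine tendsto_pi_nhds.2 fun p => ?_
    rcases eq_or_ne (min p.1 t) ⊥ with h | h
    · have hb : 𝓝[<] (⊥ : Time T) = ⊥ := by simp
      simp only [h, gridBefore_bot]
      rw [leftLim_eq_of_eq_bot _ hb]
      exact tendsto_const_nhds
    · exact ((hZ.cadlag p.2).tendsto_leftLim _).comp
        (tendsto_gridBefore (bot_lt_iff_ne_bot.2 h))

end LeftLimit

/-! ### Admissible pairs -/

section Admissible

variable [Fact ((0 : ℝ) ≤ T)] {Ω : Type*} {mΩ : MeasurableSpace Ω} {F : Filtration (Time T) mΩ}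
  {P : Measure Ω} {Z : Time T → Ω → ℝ × ℝ} {Q : ComplexMeasure (ℂ × ℂ)}
  {lam : Time T → ℂ × ℂ → ℂ}

theorem ae_mem_msupp (Q : ComplexMeasure (ℂ × ℂ)) : ∀ᵐ z ∂Q.variation, z ∈ msupp Q :=
  Measure.measure_compl_support

theorem measurableSet_msupp (Q : ComplexMeasure (ℂ × ℂ)) : MeasurableSet (msupp Q) :=
  Measure.isClosed_support.measurableSet

theorem cpow2_eq (p : Quadrant) (z : ℂ × ℂ) : cpow2 p z = expPair z (qlog p) := by
  rw [← cpow2_qexp, qexp_qlog]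

theorem measurable_cpow2 (p : Quadrant) : Measurable (cpow2 p) := by
  have e : cpow2 p = fun z => expPair z (qlog p) := funext (cpow2_eq p)
  rw [e]
  exact (continuous_expPair.comp (continuous_id.prodMk continuous_const)).measurable

theorem measurable_driftDensity (hlam : Measurable (Function.uncurry lam)) :
    Measurable (Function.uncurry (driftDensity P Z Q lam)) :=
  (measurable_jointDensity (rhoS P Z) (msupp Q) lam).add
    (hlam.mul (measurable_jointDensity (rhoS P Z) (msupp Q) (genFun P Z)))

namespace IsAdmissible

theorem exists_bounds (had : IsAdmissible P Z Q lam) (hZ : IsAdditiveProcess F P Z)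
    [IsProbabilityMeasure P] : ∃ R C : ℝ, 1 ≤ C ∧ ∀ z ∈ msupp Q, ‖re2 z‖ ≤ R ∧
      ∀ s t, s ≤ t → incMoment P Z (re2 z) s t ≤ ENNReal.ofReal C := by
  obtain ⟨R, hR⟩ := had.bounded.exists_norm_le
  obtain ⟨C₀, hC₀⟩ := had.moment_bound
  obtain ⟨c, hc, h⟩ := hZ.exists_incMoment_le R
  refine ⟨R, max 1 (c * C₀), le_max_left _ _, fun z hz => ⟨hR _ (mem_image_of_mem _ hz),
    fun s t hst => (h _ (hR _ (mem_image_of_mem _ hz)) s t hst).trans ?_⟩⟩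
  refine le_trans ?_ (ENNReal.ofReal_le_ofReal (le_max_right _ _))
  rw [ENNReal.ofReal_mul hc.le]
  refine mul_le_mul' le_rfl ?_
  rw [hZ.incMoment_bot]
  have hint : Integrable (fun ω => rexpPair (re2 z) (Z ⊤ ω)) P :=
    (had.subset hz).congr (ae_of_all _ fun ω => rpow2_qexp _ _)
  rw [← ofReal_integral_eq_lintegral_ofReal hint (ae_of_all _ fun ω => (rexpPair_pos _ _).le)]
  refine ENNReal.ofReal_le_ofReal (le_trans (le_of_eq ?_) (hC₀ _ (mem_image_of_mem _ hz)))
  exact integral_congr_ae (ae_of_all _ fun ω => (rpow2_qexp _ _).symm)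

theorem isDensity (had : IsAdmissible P Z Q lam) (hZ : IsAdditiveProcess F P Z)
    [IsProbabilityMeasure P] (hρ : StrictMono (rhoS P Z)) {z : ℂ × ℂ} (hz : z ∈ msupp Q) :
    Integrable (fun t => driftDensity P Z Q lam t z) (dMeas (rhoS P Z)) ∧
    IsDensity (rhoS P Z) (fun t => Complex.exp (genFun P Z t z) * lam t z)
      (fun t => Complex.exp (genFun P Z t z) * driftDensity P Z Q lam t z) := by
  have hA : Continuous (rhoS P Z) := continuous_rhoS
  have d1 := isDensity_jointDensity hA hρ had.borel (fun _ _ _ => rfl) had.absCont hz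
  have d2 := isDensity_jointDensity hA hρ
    (hZ.measurable_uncurry_indicator_genFun (measurableSet_msupp Q) had.subset)
    (fun t z hz => (indicator_of_mem hz _).symm) had.genFun_absCont hz
  obtain ⟨C, hC⟩ := (d1.continuous hA).exists_norm_le
  refine ⟨d1.1.add (d2.1.bdd_mul (d1.continuous hA).aestronglyMeasurable (ae_of_all _ hC)), ?_⟩
  convert (d2.cexp hA hρ.monotone).mul hA hρ.monotone d1 using 1
  funext t
  simp only [driftDensity]
  ring

theorem continuous_lam (had : IsAdmissible P Z Q lam) {z : ℂ × ℂ} (hz : z ∈ msupp Q) :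
    Continuous (fun t => lam t z) := by
  obtain ⟨ψ, hψ⟩ := had.absCont z hz
  exact hψ.continuous continuous_rhoS

/-- The backward variation-of-constants formula for `λ`. -/
theorem incChar_mul_lam (had : IsAdmissible P Z Q lam) (hZ : IsAdditiveProcess F P Z)
    [IsProbabilityMeasure P] (hρ : StrictMono (rhoS P Z)) {z : ℂ × ℂ} (hz : z ∈ msupp Q)
    {s t : Time T} (hst : s ≤ t) :
    incChar P Z s t z * lam t z = lam s z +
      ∫ u in Ioc s t, incChar P Z s u z * driftDensity P Z Q lam u z ∂(dMeas (rhoS P Z)) := by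
  have hzD := had.subset hz
  have h := (had.isDensity hZ hρ hz).2.sub_eq hst
  have h0 : Complex.exp (genFun P Z s z) ≠ 0 := Complex.exp_ne_zero _
  have e : ∀ u ∈ Ioc s t, incChar P Z s u z * driftDensity P Z Q lam u z
      = (Complex.exp (genFun P Z s z))⁻¹ *
        (Complex.exp (genFun P Z u z) * driftDensity P Z Q lam u z) := by
    intro u hu
    rw [← hZ.exp_genFun_sub hzD hu.1.le, Complex.exp_sub]
    field_simp
  rw [setIntegral_congr_fun measurableSet_Ioc e, integral_const_mul, ← h,
    ← hZ.exp_genFun_sub hzD hst, Complex.exp_sub]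
  field_simp
  ring

theorem integrable_lam (had : IsAdmissible P Z Q lam) (t : Time T) :
    Integrable (lam t) Q.variation := by
  have hm : Measurable (lam t) := had.borel.comp (measurable_const.prodMk measurable_id)
  have h2 : MemLp (lam t) 2 Q.variation := by
    refine ⟨hm.aestronglyMeasurable, ?_⟩
    rw [eLpNorm_lt_top_iff_lintegral_rpow_enorm_lt_top (by norm_num) (by norm_num)]
    simpa using had.sq_integrable t
  exact h2.integrable (by norm_num)

theorem integrable_driftDensity (had : IsAdmissible P Z Q lam) (hρ : StrictMono (rhoS P Z)) :
    Integrable (Function.uncurry (driftDensity P Z Q lam))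
      ((dMeas (rhoS P Z)).prod Q.variation) := by
  have := isFiniteMeasure_dMeas continuous_rhoS hρ.monotone
  have hm := measurable_driftDensity (P := P) (Z := Z) (Q := Q) had.borel
  refine ⟨hm.aestronglyMeasurable, ?_⟩
  rw [hasFiniteIntegral_iff_enorm, lintegral_prod _ hm.enorm.aemeasurable]
  exact had.integrable

omit [Fact ((0 : ℝ) ≤ T)] in
theorem norm_incChar_le {C : ℝ} (hC : 1 ≤ C) {z : ℂ × ℂ} {s t : Time T}
    (h : incMoment P Z (re2 z) s t ≤ ENNReal.ofReal C) : ‖incChar P Z s t z‖ ≤ C := by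
  have h1 := (enorm_incChar_le (P := P) (Z := Z) s t z).trans h
  rw [← ofReal_norm] at h1
  exact (ENNReal.ofReal_le_ofReal_iff (zero_le_one.trans hC)).1 h1

theorem exists_lam_bound (had : IsAdmissible P Z Q lam) (hZ : IsAdditiveProcess F P Z)
    [IsProbabilityMeasure P] (hρ : StrictMono (rhoS P Z)) :
    ∃ B : ℂ × ℂ → ℝ, Integrable B Q.variation ∧ ∀ z ∈ msupp Q, ∀ t, ‖lam t z‖ ≤ B z := by
  have := isFiniteMeasure_dMeas continuous_rhoS hρ.monotone
  obtain ⟨R, C, hC, h⟩ := had.exists_bounds hZ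
  refine ⟨fun z => C * ‖lam ⊤ z‖ + C * ∫ u, ‖driftDensity P Z Q lam u z‖ ∂(dMeas (rhoS P Z)),
    ((had.integrable_lam ⊤).norm.const_mul C).add
      ((had.integrable_driftDensity hρ).integral_norm_prod_right.const_mul C),
    fun z hz t => ?_⟩
  have e := had.incChar_mul_lam hZ hρ hz (le_top : t ≤ ⊤)
  have e' := eq_sub_of_add_eq e.symm
  rw [e']
  refine (norm_sub_le _ _).trans (add_le_add ?_ ?_)
  · rw [norm_mul]
    exact mul_le_mul_of_nonneg_right (norm_incChar_le hC ((h z hz).2 _ _ le_top)) (norm_nonneg _)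
  · have hi := (had.isDensity hZ hρ hz).1.norm
    refine (norm_integral_le_integral_norm _).trans ?_
    rw [← integral_const_mul]
    calc ∫ u in Ioc t ⊤, ‖incChar P Z t u z * driftDensity P Z Q lam u z‖ ∂(dMeas (rhoS P Z))
        ≤ ∫ u in Ioc t ⊤, C * ‖driftDensity P Z Q lam u z‖ ∂(dMeas (rhoS P Z)) := by
          refine integral_mono_of_nonneg (ae_of_all _ fun _ => norm_nonneg _)
            (hi.const_mul C).restrict ?_
          refine (ae_restrict_iff' measurableSet_Ioc).2 (ae_of_all _ fun u hu => ?_)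
          beta_reduce
          rw [norm_mul]
          exact mul_le_mul_of_nonneg_right
            (norm_incChar_le hC ((h z hz).2 _ _ hu.1.le)) (norm_nonneg _)
      _ ≤ _ := setIntegral_le_integral (hi.const_mul C)
          (ae_of_all _ fun u => mul_nonneg (zero_le_one.trans hC) (norm_nonneg _))

theorem norm_cpow2_le {R N : ℝ} {z : ℂ × ℂ} (hz : ‖re2 z‖ ≤ R) {p : Quadrant}
    (hp : ‖qlog p‖ ≤ N) : ‖cpow2 p z‖ ≤ Real.exp (2 * R * N) := by
  rw [cpow2_eq, norm_expPair]
  exact rexpPair_le hz hp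

theorem integrable_cpow2_mul (had : IsAdmissible P Z Q lam) (hZ : IsAdditiveProcess F P Z)
    [IsProbabilityMeasure P] {f : ℂ × ℂ → ℂ} (hf : Integrable f Q.variation) (p : Quadrant) :
    Integrable (fun z => cpow2 p z * f z) Q.variation := by
  obtain ⟨R, C, hC, h⟩ := had.exists_bounds hZ
  refine hf.bdd_mul (c := Real.exp (2 * R * ‖qlog p‖)) (measurable_cpow2 p).aestronglyMeasurable ?_
  filter_upwards [ae_mem_msupp Q] with z hz
  exact norm_cpow2_le (h z hz).1 le_rfl

theorem continuous_laplaceFun (had : IsAdmissible P Z Q lam) (hZ : IsAdditiveProcess F P Z)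
    [IsProbabilityMeasure P] (hρ : StrictMono (rhoS P Z)) :
    Continuous (fun x : Time T × Quadrant => laplaceFun Q lam x.1 x.2) := by
  obtain ⟨h, hm, h1, hQ⟩ := exists_polar Q
  obtain ⟨R, C, hC, hb⟩ := had.exists_bounds hZ
  obtain ⟨B, hB, hlam⟩ := had.exists_lam_bound hZ hρ
  simp only [laplaceFun, cint, integral_polar hm h1 hQ]
  refine continuous_iff_continuousAt.2 fun x₀ => ?_
  have hnhds : ∀ᶠ x : Time T × Quadrant in 𝓝 x₀, ‖qlog x.2‖ ≤ ‖qlog x₀.2‖ + 1 :=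
    ((continuous_qlog.comp continuous_snd).norm.tendsto x₀).eventually_le_const (lt_add_one _)
  refine continuousAt_of_dominated
    (bound := fun z => Real.exp (2 * R * (‖qlog x₀.2‖ + 1)) * B z) ?_ ?_ (hB.const_mul _) ?_
  · refine Eventually.of_forall fun x => ?_
    exact (((measurable_cpow2 x.2).mul
      (had.borel.comp (measurable_const.prodMk measurable_id))).mul hm).aestronglyMeasurable
  · filter_upwards [hnhds] with x hx
    filter_upwards [ae_mem_msupp Q] with z hz
    rw [norm_mul, h1, mul_one, norm_mul]
    exact mul_le_mul (norm_cpow2_le (hb z hz).1 hx) (hlam z hz _) (norm_nonneg _)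
      (Real.exp_pos _).le
  · filter_upwards [ae_mem_msupp Q] with z hz
    refine Continuous.continuousAt (Continuous.mul (Continuous.mul ?_ ?_) continuous_const)
    · simp only [cpow2_eq]
      exact (continuous_expPair_right z).comp (continuous_qlog.comp continuous_snd)
    · exact (had.continuous_lam hz).comp continuous_fst

theorem ae_integrable_driftDensity (had : IsAdmissible P Z Q lam) (hρ : StrictMono (rhoS P Z)) :
    ∀ᵐ t ∂(dMeas (rhoS P Z)), Integrable (driftDensity P Z Q lam t) Q.variation := by
  have := isFiniteMeasure_dMeas continuous_rhoS hρ.monotone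
  exact (had.integrable_driftDensity hρ).prod_right_ae

theorem laplaceGen_mem_locBddSpace (had : IsAdmissible P Z Q lam) (hZ : IsAdditiveProcess F P Z)
    [IsProbabilityMeasure P] (hρ : StrictMono (rhoS P Z)) {g : Time T → Quadrant → ℂ}
    (hg : ∀ᵐ t ∂(dMeas (rhoS P Z)), ∀ p, g t p = laplaceGen P Z Q lam t p) :
    g ∈ LocBddSpace Quadrant (rhoS P Z) := by
  intro K hK
  obtain ⟨h, hm, h1, hQ⟩ := exists_polar Q
  obtain ⟨R, C, hC, hb⟩ := had.exists_bounds hZ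
  obtain ⟨N, hN⟩ := hK.exists_bound_of_continuousOn continuous_qlog.continuousOn
  filter_upwards [had.ae_integrable_driftDensity hρ, hg] with t ht hgt
  refine ⟨∫ z, Real.exp (2 * R * N) * ‖driftDensity P Z Q lam t z‖ ∂Q.variation, ?_⟩
  rintro _ ⟨p, hp, rfl⟩
  beta_reduce
  rw [hgt p, laplaceGen, cint, integral_polar hm h1 hQ]
  refine (norm_integral_le_integral_norm _).trans ?_
  refine integral_mono_of_nonneg (ae_of_all _ fun _ => norm_nonneg _) (ht.norm.const_mul _) ?_
  filter_upwards [ae_mem_msupp Q] with z hz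
  rw [norm_mul, h1, mul_one, norm_mul]
  exact mul_le_mul_of_nonneg_right (norm_cpow2_le (hb z hz).1 (hN p hp)) (norm_nonneg _)

end IsAdmissible

end Admissible

/-! ### Fubini arguments for the generator -/

section Fubini

variable [Fact ((0 : ℝ) ≤ T)] {Ω : Type*} {mΩ : MeasurableSpace Ω} {F : Filtration (Time T) mΩ}
  {P : Measure Ω} {Z : Time T → Ω → ℝ × ℝ} {Q : ComplexMeasure (ℂ × ℂ)}
  {lam : Time T → ℂ × ℂ → ℂ}

theorem IsAdditiveProcess.measurable_uncurry_leftLim (hZ : IsAdditiveProcess F P Z) :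
    Measurable (fun p : Time T × Ω => Function.leftLim (fun s => Z s p.2) p.1) := by
  have h := hZ.measurable_leftLim ⊤
  simp only [le_top, inf_of_le_left] at h
  exact h.mono (sup_le_sup le_rfl (MeasurableSpace.comap_mono (F.le ⊤))) le_rfl

theorem IsAdditiveProcess.measurable_uncurry_incChar (hZ : IsAdditiveProcess F P Z)
    [IsProbabilityMeasure P] (s : Time T) :
    Measurable (fun p : Time T × (ℂ × ℂ) => incChar P Z s p.1 p.2) := by
  have e : (fun p : Time T × (ℂ × ℂ) => incChar P Z s p.1 p.2) = fun p =>
      ∫ ω, expPair p.2 (Function.leftLim (fun v => Z v ω) p.1 - Z s ω) ∂P := by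
    funext p
    refine integral_congr_ae ?_
    filter_upwards [hZ.leftLim_ae_eq p.1] with ω hω
    rw [hω]
  rw [e]
  have h : StronglyMeasurable (Function.uncurry fun (p : Time T × (ℂ × ℂ)) ω =>
      expPair p.2 (Function.leftLim (fun v => Z v ω) p.1 - Z s ω)) := by
    refine (continuous_expPair.measurable.comp (Measurable.prodMk
      (measurable_snd.comp measurable_fst) (Measurable.sub ?_ ?_))).stronglyMeasurable
    · exact hZ.measurable_uncurry_leftLim.comp
        ((measurable_fst.comp measurable_fst).prodMk measurable_snd)
    · exact (hZ.measurable s).comp measurable_snd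
  exact h.integral_prod_right.measurable

theorem lintegral_expPair_mul_le {C : ℝ} {W : Ω → ℝ × ℝ} [SFinite P]
    (hW : Measurable W)
    (hC : ∀ z ∈ msupp Q, ∫⁻ ω, ENNReal.ofReal (rexpPair (re2 z) (W ω)) ∂P ≤ ENNReal.ofReal C)
    {f : ℂ × ℂ → ℂ} (hf : Measurable f) :
    ∫⁻ ω, ∫⁻ z, ‖expPair z (W ω) * f z‖ₑ ∂Q.variation ∂P
      ≤ ENNReal.ofReal C * ∫⁻ z, ‖f z‖ₑ ∂Q.variation := by
  have hm : Measurable (fun p : Ω × (ℂ × ℂ) => expPair p.2 (W p.1) * f p.2) :=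
    (continuous_expPair.measurable.comp (measurable_snd.prodMk (hW.comp measurable_fst))).mul
      (hf.comp measurable_snd)
  rw [lintegral_lintegral_swap hm.enorm.aemeasurable, ← lintegral_const_mul _ hf.enorm]
  refine lintegral_mono_ae ?_
  filter_upwards [ae_mem_msupp Q] with z hz
  simp_rw [enorm_mul, enorm_expPair]
  have hr : Measurable (fun ω => ENNReal.ofReal (rexpPair (re2 z) (W ω))) :=
    ((continuous_rexpPair_right _).measurable.comp hW).ennreal_ofReal
  rw [lintegral_mul_const _ hr]
  exact mul_le_mul' (hC z hz) le_rfl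

/-- Fubini's theorem for Laplace integrals evaluated at a random point. -/
theorem integrable_expPair_prod [SFinite P] {C : ℝ} {W : Ω → ℝ × ℝ}
    (hW : Measurable W)
    (hC : ∀ z ∈ msupp Q, ∫⁻ ω, ENNReal.ofReal (rexpPair (re2 z) (W ω)) ∂P ≤ ENNReal.ofReal C)
    {f : ℂ × ℂ → ℂ} (hfm : Measurable f) (hf : Integrable f Q.variation) :
    Integrable (fun p : Ω × (ℂ × ℂ) => expPair p.2 (W p.1) * f p.2) (P.prod Q.variation) := by
  have hm : Measurable (fun p : Ω × (ℂ × ℂ) => expPair p.2 (W p.1) * f p.2) :=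
    (continuous_expPair.measurable.comp (measurable_snd.prodMk (hW.comp measurable_fst))).mul
      (hfm.comp measurable_snd)
  refine ⟨hm.aestronglyMeasurable, ?_⟩
  rw [hasFiniteIntegral_iff_enorm, lintegral_prod _ hm.enorm.aemeasurable]
  exact (lintegral_expPair_mul_le hW hC hfm).trans_lt
    (ENNReal.mul_lt_top ENNReal.ofReal_lt_top hf.2)

theorem setIntegral_expPair_swap [SFinite P] {C : ℝ} {W : Ω → ℝ × ℝ}
    (hW : Measurable W)
    (hC : ∀ z ∈ msupp Q, ∫⁻ ω, ENNReal.ofReal (rexpPair (re2 z) (W ω)) ∂P ≤ ENNReal.ofReal C)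
    {f : ℂ × ℂ → ℂ} (hfm : Measurable f) (hf : Integrable f Q.variation) (A : Set Ω) :
    ∫ ω in A, ∫ z, expPair z (W ω) * f z ∂Q.variation ∂P
      = ∫ z, (∫ ω in A, expPair z (W ω) ∂P) * f z ∂Q.variation := by
  rw [integral_integral_swap]
  · simp_rw [integral_mul_const]
  · have h := (integrable_expPair_prod hW hC hfm hf).integrableOn (s := A ×ˢ univ)
    rwa [IntegrableOn, ← Measure.prod_restrict, Measure.restrict_univ] at h

namespace IsAdmissible

/-- Integrating the variation-of-constants formula for `λ` over `z`. -/
theorem setIntegral_integral_incChar (had : IsAdmissible P Z Q lam) (hZ : IsAdditiveProcess F P Z)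
    [IsProbabilityMeasure P] (hρ : StrictMono (rhoS P Z)) {w : ℂ × ℂ → ℂ} {K : ℝ}
    (hw : Measurable w) (hK : ∀ z ∈ msupp Q, ‖w z‖ ≤ K) {s t : Time T} (hst : s ≤ t) :
    IntegrableOn (fun u => ∫ z, w z * (incChar P Z s u z * driftDensity P Z Q lam u z)
        ∂Q.variation) (Ioc s t) (dMeas (rhoS P Z)) ∧
    ∫ u in Ioc s t, ∫ z, w z * (incChar P Z s u z * driftDensity P Z Q lam u z)
        ∂Q.variation ∂(dMeas (rhoS P Z))
      = (∫ z, w z * (incChar P Z s t z * lam t z) ∂Q.variation)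
        - ∫ z, w z * lam s z ∂Q.variation := by
  have := isFiniteMeasure_dMeas continuous_rhoS hρ.monotone
  obtain ⟨R, C, hC, hb⟩ := had.exists_bounds hZ
  have hδ := measurable_driftDensity (P := P) (Z := Z) (Q := Q) had.borel
  have hint : Integrable (fun p : Time T × (ℂ × ℂ) =>
      w p.2 * (incChar P Z s p.1 p.2 * driftDensity P Z Q lam p.1 p.2))
      (((dMeas (rhoS P Z)).restrict (Ioc s t)).prod Q.variation) := by
    have h1 : Integrable (Function.uncurry (driftDensity P Z Q lam))
        (((dMeas (rhoS P Z)).restrict (Ioc s t)).prod Q.variation) := by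
      have h := (had.integrable_driftDensity hρ).integrableOn (s := Ioc s t ×ˢ univ)
      rwa [IntegrableOn, ← Measure.prod_restrict, Measure.restrict_univ] at h
    have h2 : ∀ᵐ p ∂(((dMeas (rhoS P Z)).restrict (Ioc s t)).prod Q.variation),
        p ∈ Ioc s t ×ˢ msupp Q := by
      have e : ((dMeas (rhoS P Z)).restrict (Ioc s t)).prod Q.variation
          = ((dMeas (rhoS P Z)).prod Q.variation).restrict (Ioc s t ×ˢ msupp Q) := by
        rw [← Measure.prod_restrict, Measure.restrict_eq_self_of_ae_mem (ae_mem_msupp Q)]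
      rw [e]
      exact ae_restrict_mem (measurableSet_Ioc.prod (measurableSet_msupp Q))
    have h3 : Integrable (fun p : Time T × (ℂ × ℂ) =>
        (w p.2 * incChar P Z s p.1 p.2) * Function.uncurry (driftDensity P Z Q lam) p)
        (((dMeas (rhoS P Z)).restrict (Ioc s t)).prod Q.variation) := by
      refine h1.bdd_mul (c := K * C) ((hw.comp measurable_snd).mul
        (hZ.measurable_uncurry_incChar s)).aestronglyMeasurable ?_
      filter_upwards [h2] with p hp
      rw [norm_mul]
      exact mul_le_mul (hK _ hp.2) (norm_incChar_le hC ((hb _ hp.2).2 _ _ hp.1.1.le))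
        (norm_nonneg _) ((norm_nonneg _).trans (hK _ hp.2))
    exact h3.congr (ae_of_all _ fun p => mul_assoc _ _ _)
  refine ⟨hint.integral_prod_left, ?_⟩
  rw [integral_integral_swap hint, ← integral_sub]
  · refine integral_congr_ae ?_
    filter_upwards [ae_mem_msupp Q] with z hz
    rw [integral_const_mul, had.incChar_mul_lam hZ hρ hz hst]
    ring
  · refine (((had.integrable_lam t).bdd_mul (c := C)
      (hZ.measurable_incChar s t).aestronglyMeasurable ?_)).bdd_mul (c := K)
      hw.aestronglyMeasurable ?_
    · filter_upwards [ae_mem_msupp Q] with z hz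
      exact norm_incChar_le hC ((hb _ hz).2 _ _ hst)
    · filter_upwards [ae_mem_msupp Q] with z hz using hK z hz
  · refine (had.integrable_lam s).bdd_mul (c := K) hw.aestronglyMeasurable ?_
    filter_upwards [ae_mem_msupp Q] with z hz using hK z hz

end IsAdmissible

end Fubini

/-! ### The drift and the martingale property -/

section Drift

variable [Fact ((0 : ℝ) ≤ T)] {Ω : Type*} {mΩ : MeasurableSpace Ω} {F : Filtration (Time T) mΩ}
  {P : Measure Ω} {Z : Time T → Ω → ℝ × ℝ} {Q : ComplexMeasure (ℂ × ℂ)}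
  {lam : Time T → ℂ × ℂ → ℂ}

omit [Fact ((0 : ℝ) ≤ T)] in
theorem laplaceFun_qexp {h : ℂ × ℂ → ℂ} (hm : Measurable h) (h1 : ∀ z, ‖h z‖ = 1)
    (hQ : Q = Q.variation.withDensityᵥ h) (t : Time T) (y : ℝ × ℝ) :
    laplaceFun Q lam t (qexp y) = ∫ z, expPair z y * (lam t z * h z) ∂Q.variation := by
  rw [laplaceFun, cint, integral_polar hm h1 hQ]
  simp_rw [cpow2_qexp, mul_assoc]

theorem laplaceGen_qexp {h : ℂ × ℂ → ℂ} (hm : Measurable h) (h1 : ∀ z, ‖h z‖ = 1)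
    (hQ : Q = Q.variation.withDensityᵥ h) (t : Time T) (y : ℝ × ℝ) :
    laplaceGen P Z Q lam t (qexp y)
      = ∫ z, expPair z y * (driftDensity P Z Q lam t z * h z) ∂Q.variation := by
  rw [laplaceGen, cint, integral_polar hm h1 hQ]
  simp_rw [cpow2_qexp, mul_assoc]

theorem integrable_mul_unimodular {X : Type*} {mX : MeasurableSpace X} {μ : Measure X}
    {f h : X → ℂ} (hf : Integrable f μ) (hm : Measurable h) (h1 : ∀ z, ‖h z‖ = 1) :
    Integrable (fun z => f z * h z) μ :=
  hf.mul_bdd (c := 1) hm.aestronglyMeasurable (ae_of_all _ fun z => (h1 z).le)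

theorem drift_laplaceGen (hZ : IsAdditiveProcess F P Z) (t : Time T) (ω : Ω) :
    drift (rhoS P Z) (expProc Z) (laplaceGen P Z Q lam) t ω =
      ∫ u in Iic t, laplaceGen P Z Q lam u (qexp (Function.leftLim (fun s => Z s ω) u))
        ∂(dMeas (rhoS P Z)) := by
  simp only [drift, hZ.leftLim_expProc]

namespace IsAdmissible

theorem stronglyMeasurable_laplaceGen (had : IsAdmissible P Z Q lam) :
    StronglyMeasurable (fun p : Time T × (ℝ × ℝ) => laplaceGen P Z Q lam p.1 (qexp p.2)) := by
  obtain ⟨h, hm, h1, hQ⟩ := exists_polar Q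
  simp_rw [laplaceGen_qexp hm h1 hQ]
  have hδ := measurable_driftDensity (P := P) (Z := Z) (Q := Q) had.borel
  have hH : StronglyMeasurable (Function.uncurry fun (p : Time T × (ℝ × ℝ)) (z : ℂ × ℂ) =>
      expPair z p.2 * (driftDensity P Z Q lam p.1 z * h z)) := by
    refine (Measurable.mul ?_ (Measurable.mul ?_ ?_)).stronglyMeasurable
    · exact continuous_expPair.measurable.comp
        (measurable_snd.prodMk (measurable_snd.comp measurable_fst))
    · exact hδ.comp ((measurable_fst.comp measurable_fst).prodMk measurable_snd)
    · exact hm.comp measurable_snd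
  exact hH.integral_prod_right

theorem integrable_laplaceGen (had : IsAdmissible P Z Q lam) (hZ : IsAdditiveProcess F P Z)
    [IsProbabilityMeasure P] (hρ : StrictMono (rhoS P Z)) :
    Integrable (fun p : Time T × Ω => laplaceGen P Z Q lam p.1
      (qexp (Function.leftLim (fun s => Z s p.2) p.1))) ((dMeas (rhoS P Z)).prod P) := by
  have := isFiniteMeasure_dMeas continuous_rhoS hρ.monotone
  obtain ⟨h, hm, h1, hQ⟩ := exists_polar Q
  obtain ⟨R, C, hC, hb⟩ := had.exists_bounds hZ
  have hδ := measurable_driftDensity (P := P) (Z := Z) (Q := Q) had.borel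
  have hs : StronglyMeasurable (fun p : Time T × Ω => laplaceGen P Z Q lam p.1
      (qexp (Function.leftLim (fun s => Z s p.2) p.1))) :=
    had.stronglyMeasurable_laplaceGen.comp_measurable
      (g := fun p : Time T × Ω => (p.1, Function.leftLim (fun s => Z s p.2) p.1))
      (measurable_fst.prodMk hZ.measurable_uncurry_leftLim)
  refine ⟨hs.aestronglyMeasurable, ?_⟩
  rw [hasFiniteIntegral_iff_enorm, lintegral_prod _ hs.measurable.enorm.aemeasurable]
  calc ∫⁻ u, ∫⁻ ω, ‖laplaceGen P Z Q lam u (qexp (Function.leftLim (fun s => Z s ω) u))‖ₑ ∂P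
        ∂(dMeas (rhoS P Z))
      ≤ ∫⁻ u, ENNReal.ofReal C * ∫⁻ z, ‖driftDensity P Z Q lam u z‖ₑ ∂Q.variation
        ∂(dMeas (rhoS P Z)) := by
        refine lintegral_mono fun u => ?_
        have hδu : Measurable (fun z => driftDensity P Z Q lam u z * h z) :=
          (hδ.comp (measurable_const.prodMk measurable_id)).mul hm
        have hle := lintegral_expPair_mul_le (Q := Q) (P := P) (hZ.measurable u)
          (fun z hz => (hZ.incMoment_bot (re2 z) u).symm.le.trans ((hb z hz).2 _ _ bot_le)) hδu
        have hn : ∀ z, ‖driftDensity P Z Q lam u z * h z‖ₑ = ‖driftDensity P Z Q lam u z‖ₑ := by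
          intro z
          rw [← ofReal_norm, norm_mul, h1, mul_one, ofReal_norm]
        simp_rw [hn] at hle
        refine le_trans (lintegral_mono_ae ?_) hle
        filter_upwards [hZ.leftLim_ae_eq u] with ω hω
        rw [hω, laplaceGen_qexp hm h1 hQ]
        exact enorm_integral_le_lintegral_enorm _
    _ < ∞ := by
        rw [lintegral_const_mul' _ _ ENNReal.ofReal_ne_top]
        exact ENNReal.mul_lt_top ENNReal.ofReal_lt_top had.integrable

theorem ae_integrable_laplaceGen (had : IsAdmissible P Z Q lam) (hZ : IsAdditiveProcess F P Z)
    [IsProbabilityMeasure P] (hρ : StrictMono (rhoS P Z)) :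
    ∀ᵐ ω ∂P, Integrable (fun u => laplaceGen P Z Q lam u
      (qexp (Function.leftLim (fun s => Z s ω) u))) (dMeas (rhoS P Z)) := by
  have := isFiniteMeasure_dMeas continuous_rhoS hρ.monotone
  exact (had.integrable_laplaceGen hZ hρ).prod_left_ae

theorem stronglyAdapted_drift (had : IsAdmissible P Z Q lam) (hZ : IsAdditiveProcess F P Z)
    [IsProbabilityMeasure P] (hρ : StrictMono (rhoS P Z)) :
    StronglyAdapted F (drift (rhoS P Z) (expProc Z) (laplaceGen P Z Q lam)) := by
  have := isFiniteMeasure_dMeas continuous_rhoS hρ.monotone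
  intro t
  have e : drift (rhoS P Z) (expProc Z) (laplaceGen P Z Q lam) t = fun ω =>
      ∫ u in Iic t, laplaceGen P Z Q lam u (qexp (Function.leftLim (fun s => Z s ω) (min u t)))
        ∂(dMeas (rhoS P Z)) := by
    funext ω
    rw [drift_laplaceGen hZ]
    refine setIntegral_congr_fun measurableSet_Iic fun u hu => ?_
    rw [min_eq_left hu]
  rw [e]
  have h1 := hZ.measurable_leftLim t
  have h2 := had.stronglyMeasurable_laplaceGen
  let _ : MeasurableSpace Ω := F t
  have h3 : StronglyMeasurable (fun p : Time T × Ω => laplaceGen P Z Q lam p.1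
      (qexp (Function.leftLim (fun s => Z s p.2) (min p.1 t)))) :=
    h2.comp_measurable
      (g := fun p : Time T × Ω => (p.1, Function.leftLim (fun s => Z s p.2) (min p.1 t)))
      (measurable_fst.prodMk h1)
  exact h3.integral_prod_left'

theorem ae_drift_path (had : IsAdmissible P Z Q lam) (hZ : IsAdditiveProcess F P Z)
    [IsProbabilityMeasure P] (hρ : StrictMono (rhoS P Z)) :
    ∀ᵐ ω ∂P, Continuous (fun t => drift (rhoS P Z) (expProc Z) (laplaceGen P Z Q lam) t ω) ∧
      BoundedVariationOn
        (fun t => drift (rhoS P Z) (expProc Z) (laplaceGen P Z Q lam) t ω) univ := by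
  have := nullSingletonClass_dMeas (A := rhoS P Z) continuous_rhoS
  filter_upwards [had.ae_integrable_laplaceGen hZ hρ] with ω hω
  simp_rw [drift_laplaceGen hZ]
  exact ⟨continuous_setIntegral_Iic hω, boundedVariationOn_setIntegral_Iic hω⟩

theorem integrable_drift (had : IsAdmissible P Z Q lam) (hZ : IsAdditiveProcess F P Z)
    [IsProbabilityMeasure P] (hρ : StrictMono (rhoS P Z)) (t : Time T) :
    Integrable (drift (rhoS P Z) (expProc Z) (laplaceGen P Z Q lam) t) P := by
  have := isFiniteMeasure_dMeas continuous_rhoS hρ.monotone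
  have h := (had.integrable_laplaceGen hZ hρ).integrableOn (s := Iic t ×ˢ univ)
  rw [IntegrableOn, ← Measure.prod_restrict, Measure.restrict_univ] at h
  exact h.integral_prod_right.congr (ae_of_all _ fun ω => (drift_laplaceGen hZ t ω).symm)

/-- Integrals of Laplace transforms over past events. -/
theorem setIntegral_laplace (had : IsAdmissible P Z Q lam) (hZ : IsAdditiveProcess F P Z)
    [IsProbabilityMeasure P] {f : ℂ × ℂ → ℂ} (hfm : Measurable f)
    (hf : Integrable f Q.variation) {s t : Time T} (hst : s ≤ t) {A : Set Ω}
    (hA : MeasurableSet[F s] A) :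
    Integrable (fun ω => ∫ z, expPair z (Z t ω) * f z ∂Q.variation) P ∧
    ∫ ω in A, ∫ z, expPair z (Z t ω) * f z ∂Q.variation ∂P
      = ∫ z, (∫ ω in A, expPair z (Z s ω) ∂P) * (incChar P Z s t z * f z) ∂Q.variation := by
  obtain ⟨R, C, hC, hb⟩ := had.exists_bounds hZ
  have hbt : ∀ z ∈ msupp Q, ∫⁻ ω, ENNReal.ofReal (rexpPair (re2 z) (Z t ω)) ∂P
      ≤ ENNReal.ofReal C :=
    fun z hz => (hZ.incMoment_bot (re2 z) t).symm.le.trans ((hb z hz).2 _ _ bot_le)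
  refine ⟨(integrable_expPair_prod (hZ.measurable t) hbt hfm hf).integral_prod_left, ?_⟩
  rw [setIntegral_expPair_swap (hZ.measurable t) hbt hfm hf]
  refine integral_congr_ae (ae_of_all _ fun z => ?_)
  have hX : Measurable[F s] (A.indicator fun ω => expPair z (Z s ω)) :=
    Measurable.indicator ((continuous_expPair_right z).measurable.comp (hZ.adapted s)) hA
  have h := hZ.integral_mul_inc hst hX z
  have hA' := F.le s _ hA
  rw [integral_indicator hA'] at h
  beta_reduce
  rw [← mul_assoc, ← h, ← integral_indicator hA']
  congr 1
  refine integral_congr_ae (ae_of_all _ fun ω => ?_)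
  by_cases hω : ω ∈ A
  · simp only [indicator_of_mem hω]
    rw [← expPair_add]
    congr 1
    abel
  · simp [indicator_of_notMem hω]

theorem integrable_laplaceFun (had : IsAdmissible P Z Q lam) (hZ : IsAdditiveProcess F P Z)
    [IsProbabilityMeasure P] (t : Time T) :
    Integrable (fun ω => laplaceFun Q lam t (expProc Z t ω)) P := by
  obtain ⟨h, hm, h1, hQ⟩ := exists_polar Q
  have hlm : Measurable (lam t) := had.borel.comp (measurable_const.prodMk measurable_id)
  exact (had.setIntegral_laplace hZ (hlm.mul hm)
    (integrable_mul_unimodular (had.integrable_lam t) hm h1) le_rfl MeasurableSet.univ).1.congr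
    (ae_of_all _ fun ω => (laplaceFun_qexp hm h1 hQ t (Z t ω)).symm)

theorem setIntegral_drift_sub (had : IsAdmissible P Z Q lam) (hZ : IsAdditiveProcess F P Z)
    [IsProbabilityMeasure P] (hρ : StrictMono (rhoS P Z)) {s t : Time T} (hst : s ≤ t)
    {A : Set Ω} (hA : MeasurableSet[F s] A) :
    ∫ ω in A, (drift (rhoS P Z) (expProc Z) (laplaceGen P Z Q lam) t ω
        - drift (rhoS P Z) (expProc Z) (laplaceGen P Z Q lam) s ω) ∂P
      = ∫ ω in A, laplaceFun Q lam t (expProc Z t ω) ∂P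
        - ∫ ω in A, laplaceFun Q lam s (expProc Z s ω) ∂P := by
  have := isFiniteMeasure_dMeas continuous_rhoS hρ.monotone
  obtain ⟨h, hm, h1, hQ⟩ := exists_polar Q
  obtain ⟨R, C, hC, hb⟩ := had.exists_bounds hZ
  have hδ := measurable_driftDensity (P := P) (Z := Z) (Q := Q) had.borel
  have hlm : ∀ t, Measurable (lam t) := fun t =>
    had.borel.comp (measurable_const.prodMk measurable_id)
  set w : ℂ × ℂ → ℂ := fun z => ∫ ω in A, expPair z (Z s ω) ∂P with hw
  have hwm : Measurable w := by
    have hH : StronglyMeasurable (Function.uncurry fun (z : ℂ × ℂ) ω => expPair z (Z s ω)) :=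
      (continuous_expPair.measurable.comp
        (measurable_fst.prodMk ((hZ.measurable s).comp measurable_snd))).stronglyMeasurable
    exact hH.integral_prod_right.measurable
  have hwC : ∀ z ∈ msupp Q, ‖w z * h z‖ ≤ C := by
    intro z hz
    rw [norm_mul, h1, mul_one]
    have h2 : ‖w z‖ₑ ≤ ENNReal.ofReal C := by
      refine ((enorm_integral_le_lintegral_enorm _).trans
        (setLIntegral_le_lintegral _ _)).trans ?_
      simp_rw [enorm_expPair]
      exact (hZ.incMoment_bot (re2 z) s).symm.le.trans ((hb z hz).2 _ _ bot_le)
    rw [← ofReal_norm] at h2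
    exact (ENNReal.ofReal_le_ofReal_iff (zero_le_one.trans hC)).1 h2
  have hF : ∀ v, s ≤ v → ∫ ω in A, laplaceFun Q lam v (expProc Z v ω) ∂P
      = ∫ z, w z * h z * (incChar P Z s v z * lam v z) ∂Q.variation := by
    intro v hv
    have e := (had.setIntegral_laplace hZ ((hlm v).mul hm)
      (integrable_mul_unimodular (had.integrable_lam v) hm h1) hv hA).2
    calc ∫ ω in A, laplaceFun Q lam v (expProc Z v ω) ∂P
        = ∫ ω in A, ∫ z, expPair z (Z v ω) * (lam v z * h z) ∂Q.variation ∂P :=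
          integral_congr_ae (ae_of_all _ fun ω => laplaceFun_qexp hm h1 hQ v (Z v ω))
      _ = _ := e
      _ = _ := integral_congr_ae (ae_of_all _ fun z => by
          simp only [hw, Pi.mul_apply]
          ring)
  have key := (had.setIntegral_integral_incChar hZ hρ (hwm.mul hm) hwC hst).2
  rw [hF t hst, hF s le_rfl]
  simp_rw [hZ.incChar_self, one_mul]
  refine Eq.trans ?_ key
  have hi := had.integrable_laplaceGen hZ hρ
  have hi' : Integrable (Function.uncurry fun ω u => laplaceGen P Z Q lam u
      (qexp (Function.leftLim (fun s => Z s ω) u)))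
      ((P.restrict A).prod ((dMeas (rhoS P Z)).restrict (Ioc s t))) := by
    have h2 := hi.integrableOn (s := Ioc s t ×ˢ A)
    rw [IntegrableOn, ← Measure.prod_restrict] at h2
    exact h2.swap
  calc ∫ ω in A, (drift (rhoS P Z) (expProc Z) (laplaceGen P Z Q lam) t ω
        - drift (rhoS P Z) (expProc Z) (laplaceGen P Z Q lam) s ω) ∂P
      = ∫ ω in A, ∫ u in Ioc s t, laplaceGen P Z Q lam u
          (qexp (Function.leftLim (fun s => Z s ω) u)) ∂(dMeas (rhoS P Z)) ∂P := by
        refine integral_congr_ae (ae_restrict_of_ae ?_)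
        filter_upwards [had.ae_integrable_laplaceGen hZ hρ] with ω hω
        rw [drift_laplaceGen hZ, drift_laplaceGen hZ, setIntegral_Ioc_eq_sub hω hst]
    _ = ∫ u in Ioc s t, ∫ ω in A, laplaceGen P Z Q lam u
          (qexp (Function.leftLim (fun s => Z s ω) u)) ∂P ∂(dMeas (rhoS P Z)) :=
        integral_integral_swap hi'
    _ = _ := by
        refine integral_congr_ae ?_
        filter_upwards [ae_restrict_of_ae (had.ae_integrable_driftDensity hρ),
          ae_restrict_mem measurableSet_Ioc] with u hu hus
        have hδu : Measurable (driftDensity P Z Q lam u) :=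
          hδ.comp (measurable_const.prodMk measurable_id)
        have e := (had.setIntegral_laplace hZ (hδu.mul hm)
          (integrable_mul_unimodular hu hm h1) hus.1.le hA).2
        calc ∫ ω in A, laplaceGen P Z Q lam u (qexp (Function.leftLim (fun s => Z s ω) u)) ∂P
            = ∫ ω in A, ∫ z, expPair z (Z u ω) * (driftDensity P Z Q lam u z * h z)
                ∂Q.variation ∂P := by
              refine integral_congr_ae (ae_restrict_of_ae ?_)
              filter_upwards [hZ.leftLim_ae_eq u] with ω hω
              rw [hω, laplaceGen_qexp hm h1 hQ]
          _ = _ := e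
          _ = _ := integral_congr_ae (ae_of_all _ fun z => by
              simp only [hw, Pi.mul_apply]
              ring)

theorem martingale (had : IsAdmissible P Z Q lam) (hZ : IsAdditiveProcess F P Z)
    [IsProbabilityMeasure P] (hρ : StrictMono (rhoS P Z)) :
    Martingale (fun t ω => laplaceFun Q lam t (expProc Z t ω)
      - drift (rhoS P Z) (expProc Z) (laplaceGen P Z Q lam) t ω) F P := by
  have hD := had.stronglyAdapted_drift hZ hρ
  have hDi := had.integrable_drift hZ hρ
  have hfi := had.integrable_laplaceFun hZ
  have hf : ∀ t, StronglyMeasurable[F t] (fun ω => laplaceFun Q lam t (expProc Z t ω)) := by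
    intro t
    have hc : Continuous (fun y : ℝ × ℝ => laplaceFun Q lam t (qexp y)) :=
      Continuous.comp (f := fun y : ℝ × ℝ => ((t, qexp y) : Time T × Quadrant))
        (had.continuous_laplaceFun hZ hρ) (continuous_const.prodMk continuous_qexp)
    exact hc.stronglyMeasurable.comp_measurable (g := Z t) (hZ.adapted t)
  refine ⟨fun t => (hf t).sub (hD t), fun s t hst => ?_⟩
  refine (ae_eq_condExp_of_forall_setIntegral_eq (F.le s) ((hfi t).sub (hDi t))
    (fun A _ _ => ((hfi s).sub (hDi s)).integrableOn) (fun A hA _ => ?_)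
    ((hf s).sub (hD s)).aestronglyMeasurable).symm
  have h1 := had.setIntegral_drift_sub hZ hρ hst hA
  rw [integral_sub (hDi t).integrableOn (hDi s).integrableOn] at h1
  simp only [Pi.sub_apply]
  rw [integral_sub (hfi t).integrableOn (hDi t).integrableOn,
    integral_sub (hfi s).integrableOn (hDi s).integrableOn]
  linear_combination h1

theorem ae_isCadlag (had : IsAdmissible P Z Q lam) (hZ : IsAdditiveProcess F P Z)
    [IsProbabilityMeasure P] (hρ : StrictMono (rhoS P Z)) :
    ∀ᵐ ω ∂P, IsCadlag (fun t => laplaceFun Q lam t (expProc Z t ω)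
      - drift (rhoS P Z) (expProc Z) (laplaceGen P Z Q lam) t ω) := by
  filter_upwards [had.ae_drift_path hZ hρ] with ω hω
  have hY : IsCadlag (fun t => expProc Z t ω) := (hZ.cadlag ω).comp_continuous continuous_qexp
  have hc := had.continuous_laplaceFun hZ hρ
  intro t
  obtain ⟨h1, l, hl⟩ := hY t
  have h2 : ∀ (m : Quadrant) (k : Filter (Time T)), k ≤ 𝓝 t →
      Tendsto (fun t => expProc Z t ω) k (𝓝 m) →
      Tendsto (fun t => laplaceFun Q lam t (expProc Z t ω)) k (𝓝 (laplaceFun Q lam t m)) :=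
    fun m k hk hm => Tendsto.comp (f := fun t => (t, expProc Z t ω)) (hc.tendsto (t, m))
      ((tendsto_id.mono_left hk).prodMk_nhds hm)
  exact ⟨(h2 _ _ nhdsWithin_le_nhds h1).sub hω.1.continuousWithinAt,
    _, (h2 l _ nhdsWithin_le_nhds hl).sub ((hω.1.tendsto t).mono_left nhdsWithin_le_nhds)⟩

end IsAdmissible

end Drift

/-! ### The operator is well defined -/

section Operator

variable [Fact ((0 : ℝ) ≤ T)] {Ω : Type*} {mΩ : MeasurableSpace Ω} {F : Filtration (Time T) mΩ}
  {P : Measure Ω} {Z : Time T → Ω → ℝ × ℝ} {Q Q' : ComplexMeasure (ℂ × ℂ)}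
  {lam lam' : Time T → ℂ × ℂ → ℂ}

/-- The generator at time `u`, averaged over the increment of `Z` between `s` and `u`. -/
def incGen (P : Measure Ω) (Z : Time T → Ω → ℝ × ℝ) (Q : ComplexMeasure (ℂ × ℂ))
    (lam : Time T → ℂ × ℂ → ℂ) (s u : Time T) (y : ℝ × ℝ) : ℂ :=
  cint Q (fun z => expPair z y * (incChar P Z s u z * driftDensity P Z Q lam u z))

namespace IsAdmissible

theorem setIntegral_incGen (had : IsAdmissible P Z Q lam) (hZ : IsAdditiveProcess F P Z)
    [IsProbabilityMeasure P] (hρ : StrictMono (rhoS P Z)) (y : ℝ × ℝ) {s t : Time T}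
    (hst : s ≤ t) :
    IntegrableOn (fun u => incGen P Z Q lam s u y) (Ioc s t) (dMeas (rhoS P Z)) ∧
    ∫ u in Ioc s t, incGen P Z Q lam s u y ∂(dMeas (rhoS P Z))
      = (∫ ω, laplaceFun Q lam t (qexp (y + (Z t ω - Z s ω))) ∂P)
        - laplaceFun Q lam s (qexp y) := by
  obtain ⟨h, hm, h1, hQ⟩ := exists_polar Q
  obtain ⟨R, C, hC, hb⟩ := had.exists_bounds hZ
  have hlm : Measurable (lam t) := had.borel.comp (measurable_const.prodMk measurable_id)
  have hym : Measurable (fun z => expPair z y) :=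
    (continuous_expPair.comp (continuous_id.prodMk continuous_const)).measurable
  have hyb : ∀ z ∈ msupp Q, ‖expPair z y‖ ≤ Real.exp (2 * R * ‖y‖) := fun z hz => by
    rw [norm_expPair]
    exact rexpPair_le (hb z hz).1 le_rfl
  have hw : ∀ z ∈ msupp Q, ‖expPair z y * h z‖ ≤ Real.exp (2 * R * ‖y‖) := fun z hz => by
    rw [norm_mul, h1, mul_one]
    exact hyb z hz
  have key := had.setIntegral_integral_incChar hZ hρ (hym.mul hm) hw hst
  have e : ∀ u, incGen P Z Q lam s u y = ∫ z, (expPair z y * h z) *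
      (incChar P Z s u z * driftDensity P Z Q lam u z) ∂Q.variation := fun u => by
    rw [incGen, cint, integral_polar hm h1 hQ]
    exact integral_congr_ae (ae_of_all _ fun z => by ring)
  simp_rw [e]
  refine ⟨key.1, key.2.trans ?_⟩
  congr 1
  · have hf : Integrable (fun z => expPair z y * (lam t z * h z)) Q.variation := by
      refine (integrable_mul_unimodular (had.integrable_lam t) hm h1).bdd_mul
        (c := Real.exp (2 * R * ‖y‖)) hym.aestronglyMeasurable ?_
      filter_upwards [ae_mem_msupp Q] with z hz using hyb z hz
    have hsw := setIntegral_expPair_swap (P := P) (hZ.measurable_sub s t)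
      (fun z hz => (hb z hz).2 s t hst) (hym.mul (hlm.mul hm)) hf univ
    simp only [Measure.restrict_univ, Pi.mul_apply] at hsw
    simp_rw [laplaceFun_qexp hm h1 hQ]
    calc ∫ z, expPair z y * h z * (incChar P Z s t z * lam t z) ∂Q.variation
        = ∫ z, incChar P Z s t z * (expPair z y * (lam t z * h z)) ∂Q.variation :=
          integral_congr_ae (ae_of_all _ fun z => by ring)
      _ = _ := hsw.symm
      _ = _ := by
          refine integral_congr_ae (ae_of_all _ fun ω => integral_congr_ae (ae_of_all _ fun z => ?_))
          simp only [expPair_add]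
          ring
  · rw [laplaceFun_qexp hm h1 hQ]
    exact integral_congr_ae (ae_of_all _ fun z => by
      simp only [Pi.mul_apply]
      ring)

theorem ae_incGen_eq (had : IsAdmissible P Z Q lam) (had' : IsAdmissible P Z Q' lam')
    (hZ : IsAdditiveProcess F P Z) [IsProbabilityMeasure P] (hρ : StrictMono (rhoS P Z))
    (heq : laplaceFun Q lam = laplaceFun Q' lam') (s : Time T) (y : ℝ × ℝ) :
    ∀ᵐ u ∂(dMeas (rhoS P Z)), s < u → incGen P Z Q lam s u y = incGen P Z Q' lam' s u y := by
  have hi := (had.setIntegral_incGen hZ hρ y (le_top : s ≤ ⊤)).1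
  have hi' := (had'.setIntegral_incGen hZ hρ y (le_top : s ≤ ⊤)).1
  have hIoc : Ioc s ⊤ = Ioi s := by ext; simp
  rw [hIoc] at hi hi'
  have h0 := ae_eq_zero_of_setIntegral_Iic
    (ψ := (Ioi s).indicator fun u => incGen P Z Q lam s u y - incGen P Z Q' lam' s u y)
    ((integrable_indicator_iff measurableSet_Ioi).2 (hi.sub hi')) fun t => ?_
  · filter_upwards [h0] with u hu hsu
    rw [indicator_of_mem (mem_Ioi.2 hsu)] at hu
    exact sub_eq_zero.1 hu
  · rw [setIntegral_indicator measurableSet_Ioi, Iic_inter_Ioi]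
    rcases le_total s t with hst | hst
    · obtain ⟨h1, h2⟩ := had.setIntegral_incGen hZ hρ y hst
      obtain ⟨h1', h2'⟩ := had'.setIntegral_incGen hZ hρ y hst
      rw [integral_sub h1 h1', h2, h2', heq, sub_self]
    · simp [Ioc_eq_empty_of_le hst]

theorem tendsto_incGen (had : IsAdmissible P Z Q lam) (hZ : IsAdditiveProcess F P Z)
    [IsProbabilityMeasure P] {u : Time T}
    (hu : Integrable (driftDensity P Z Q lam u) Q.variation) (y : ℝ × ℝ) :
    Tendsto (fun p : Time T × (ℝ × ℝ) => incGen P Z Q lam p.1 u p.2) (𝓝[<] u ×ˢ 𝓝 y)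
      (𝓝 (laplaceGen P Z Q lam u (qexp y))) := by
  obtain ⟨h, hm, h1, hQ⟩ := exists_polar Q
  obtain ⟨R, C, hC, hb⟩ := had.exists_bounds hZ
  simp only [incGen, cint, integral_polar hm h1 hQ]
  rw [laplaceGen_qexp hm h1 hQ]
  have hs : ∀ᶠ p : Time T × (ℝ × ℝ) in 𝓝[<] u ×ˢ 𝓝 y, p.1 < u :=
    tendsto_fst.eventually eventually_mem_nhdsWithin
  have hn : ∀ᶠ p : Time T × (ℝ × ℝ) in 𝓝[<] u ×ˢ 𝓝 y, ‖p.2‖ ≤ ‖y‖ + 1 :=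
    tendsto_snd.eventually ((continuous_norm.tendsto y).eventually_le_const (lt_add_one _))
  refine tendsto_integral_filter_of_dominated_convergence
    (fun z => Real.exp (2 * R * (‖y‖ + 1)) * (C * ‖driftDensity P Z Q lam u z‖)) ?_ ?_
    ((hu.norm.const_mul C).const_mul _) ?_
  · refine Eventually.of_forall fun p => AEStronglyMeasurable.mul
      (AEStronglyMeasurable.mul ?_ (AEStronglyMeasurable.mul
        (hZ.measurable_incChar _ _).aestronglyMeasurable hu.1)) hm.aestronglyMeasurable
    exact (continuous_expPair.comp
      (continuous_id.prodMk continuous_const)).measurable.aestronglyMeasurable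
  · filter_upwards [hs, hn] with p hp hpn
    filter_upwards [ae_mem_msupp Q] with z hz
    rw [norm_mul, h1, mul_one, norm_mul, norm_mul, norm_expPair]
    refine mul_le_mul (rexpPair_le (hb z hz).1 hpn) ?_ (by positivity) (Real.exp_pos _).le
    exact mul_le_mul_of_nonneg_right (norm_incChar_le hC ((hb z hz).2 _ _ hp.le)) (norm_nonneg _)
  · filter_upwards [ae_mem_msupp Q] with z hz
    have hzD := had.subset hz
    have hc : Tendsto (fun s => incChar P Z s u z) (𝓝[<] u) (𝓝 1) := by
      have h2 : Tendsto (fun s => incChar P Z ⊥ u z / incChar P Z ⊥ s z) (𝓝[<] u) (𝓝 1) := by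
        have h3 := (tendsto_const_nhds (x := incChar P Z ⊥ u z)).div
          ((hZ.continuous_incChar hzD).tendsto u) (hZ.incChar_ne_zero hzD u)
        rw [div_self (hZ.incChar_ne_zero hzD u)] at h3
        exact h3.mono_left nhdsWithin_le_nhds
      refine h2.congr' ?_
      filter_upwards [self_mem_nhdsWithin] with s hsu
      rw [hZ.incChar_mul z bot_le (le_of_lt hsu),
        mul_div_cancel_left₀ _ (hZ.incChar_ne_zero hzD s)]
    have hy := ((continuous_expPair_right z).tendsto y).comp
      (tendsto_snd (f := 𝓝[<] u) (g := 𝓝 y))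
    have h4 := (hy.mul ((hc.comp (tendsto_fst (f := 𝓝[<] u) (g := 𝓝 y))).mul
      (tendsto_const_nhds (x := driftDensity P Z Q lam u z)))).mul
      (tendsto_const_nhds (x := h z))
    rw [one_mul, mul_assoc] at h4
    exact h4

theorem ae_laplaceGen_eq (had : IsAdmissible P Z Q lam) (had' : IsAdmissible P Z Q' lam')
    (hZ : IsAdditiveProcess F P Z) [IsProbabilityMeasure P] (hρ : StrictMono (rhoS P Z))
    (heq : laplaceFun Q lam = laplaceFun Q' lam') :
    ∀ᵐ u ∂(dMeas (rhoS P Z)), ∀ p, laplaceGen P Z Q lam u p = laplaceGen P Z Q' lam' u p := by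
  obtain ⟨S, hSc, hSd⟩ := TopologicalSpace.exists_countable_dense (Time T)
  obtain ⟨D, hDc, hDd⟩ := TopologicalSpace.exists_countable_dense (ℝ × ℝ)
  have hall : ∀ᵐ u ∂(dMeas (rhoS P Z)), ∀ s ∈ S, ∀ y ∈ D, s < u →
      incGen P Z Q lam s u y = incGen P Z Q' lam' s u y :=
    (ae_ball_iff hSc).2 fun s _ => (ae_ball_iff hDc).2 fun y _ =>
      had.ae_incGen_eq had' hZ hρ heq s y
  have hbot : ∀ᵐ u ∂(dMeas (rhoS P Z)), u ≠ ⊥ := by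
    rw [ae_iff]
    simpa using dMeas_singleton continuous_rhoS (⊥ : Time T)
  filter_upwards [hall, hbot, had.ae_integrable_driftDensity hρ,
    had'.ae_integrable_driftDensity hρ] with u hu hub hi hi' p
  rw [← qexp_qlog p]
  set y := qlog p
  have : (𝓝[Iio u ∩ S] u).NeBot := by
    rw [← mem_closure_iff_nhdsWithin_neBot]
    have h1 : u ∈ closure (Iio u) := by
      rw [closure_Iio' ⟨⊥, bot_lt_iff_ne_bot.2 hub⟩]
      exact self_mem_Iic
    exact closure_minimal (hSd.open_subset_closure_inter isOpen_Iio) isClosed_closure h1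
  have : (𝓝[D] y).NeBot := mem_closure_iff_nhdsWithin_neBot.1 (hDd y)
  have hle : 𝓝[Iio u ∩ S] u ×ˢ 𝓝[D] y ≤ 𝓝[<] u ×ˢ 𝓝 y :=
    Filter.prod_mono (nhdsWithin_mono _ inter_subset_left) nhdsWithin_le_nhds
  refine tendsto_nhds_unique_of_eventuallyEq ((had.tendsto_incGen hZ hi y).mono_left hle)
    ((had'.tendsto_incGen hZ hi' y).mono_left hle) ?_
  have h2 : ∀ᶠ q : Time T × (ℝ × ℝ) in 𝓝[Iio u ∩ S] u ×ˢ 𝓝[D] y, q.1 ∈ Iio u ∩ S :=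
    tendsto_fst.eventually eventually_mem_nhdsWithin
  have h3 : ∀ᶠ q : Time T × (ℝ × ℝ) in 𝓝[Iio u ∩ S] u ×ˢ 𝓝[D] y, q.2 ∈ D :=
    tendsto_snd.eventually eventually_mem_nhdsWithin
  filter_upwards [h2, h3] with q hq hqD
  exact hu q.1 hq.2 q.2 hqD hq.1

end IsAdmissible

theorem exists_isLaplaceOperator (hZ : IsAdditiveProcess F P Z) [IsProbabilityMeasure P]
    (hρ : StrictMono (rhoS P Z)) : ∃ a, IsLaplaceOperator P Z a := by
  classical
  refine ⟨fun f => if h : ∃ x : ComplexMeasure (ℂ × ℂ) × (Time T → ℂ × ℂ → ℂ),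
    IsAdmissible P Z x.1 x.2 ∧ f = laplaceFun x.1 x.2
    then laplaceGen P Z h.choose.1 h.choose.2 else 0, fun Q lam had => ?_⟩
  have h : ∃ x : ComplexMeasure (ℂ × ℂ) × (Time T → ℂ × ℂ → ℂ),
    IsAdmissible P Z x.1 x.2 ∧ laplaceFun Q lam = laplaceFun x.1 x.2 := ⟨(Q, lam), had, rfl⟩
  beta_reduce
  rw [dif_pos h]
  exact h.choose_spec.1.ae_laplaceGen_eq had hZ hρ h.choose_spec.2.symm

theorem IsLaplaceOperator.drift_eq {a : (Time T → Quadrant → ℂ) → (Time T → Quadrant → ℂ)}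
    (ha : IsLaplaceOperator P Z a) (had : IsAdmissible P Z Q lam) :
    drift (rhoS P Z) (expProc Z) (a (laplaceFun Q lam))
      = drift (rhoS P Z) (expProc Z) (laplaceGen P Z Q lam) := by
  funext t ω
  refine integral_congr_ae (ae_restrict_of_ae ?_)
  filter_upwards [ha Q lam had] with u hu
  exact hu _

theorem IsLaplaceOperator.solvesStrongMP
    {a : (Time T → Quadrant → ℂ) → (Time T → Quadrant → ℂ)} (ha : IsLaplaceOperator P Z a)
    (hZ : IsAdditiveProcess F P Z) [IsProbabilityMeasure P] (hρ : StrictMono (rhoS P Z)) :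
    SolvesStrongMP F P Quadrant (opDomain P Z) a (rhoS P Z) (expProc Z) where
  continuous_integrator := continuous_rhoS
  monotone_integrator := hρ.monotone
  cadlag ω := (hZ.cadlag ω).comp_continuous continuous_qexp
  adapted t := continuous_qexp.measurable.comp (hZ.adapted t)
  dom_continuous := by
    rintro _ ⟨Q, lam, had, rfl⟩
    exact had.continuous_laplaceFun hZ hρ
  map_mem := by
    rintro _ ⟨Q, lam, had, rfl⟩
    exact had.laplaceGen_mem_locBddSpace hZ hρ (ha Q lam had)
  drift_integrable := by
    rintro _ ⟨Q, lam, had, rfl⟩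
    filter_upwards [had.ae_integrable_laplaceGen hZ hρ] with ω hω
    refine hω.congr ?_
    filter_upwards [ha Q lam had] with u hu
    rw [hu, hZ.leftLim_expProc]
  drift_adapted := by
    rintro _ ⟨Q, lam, had, rfl⟩
    rw [ha.drift_eq had]
    exact had.stronglyAdapted_drift hZ hρ
  drift_path := by
    rintro _ ⟨Q, lam, had, rfl⟩
    rw [ha.drift_eq had]
    exact had.ae_drift_path hZ hρ
  local_martingale := by
    rintro _ ⟨Q, lam, had, rfl⟩
    rw [ha.drift_eq had]
    exact Locally.of_prop ⟨had.martingale hZ hρ, had.ae_isCadlag hZ hρ⟩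

end Operator

end StrongMP

end

theorem mainTheorem6 {Ω : Type*} [mΩ : MeasurableSpace Ω] (P : Measure Ω) [IsProbabilityMeasure P]
    (T : ℝ) [Fact ((0 : ℝ) ≤ T)] (hT : 0 < T)
    (F : Filtration (StrongMP.Time T) mΩ)
    (Z : StrongMP.Time T → Ω → ℝ × ℝ) (hZ : StrongMP.IsAdditiveProcess F P Z)
    (hρ : StrictMono (StrongMP.rhoS P Z))
    (hD : ((0, 2) : ℂ × ℂ) ∈ StrongMP.expDomain P Z) :
    (∀ (Q : ComplexMeasure (ℂ × ℂ)) (lam : StrongMP.Time T → ℂ × ℂ → ℂ),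
      StrongMP.IsAdmissible P Z Q lam →
        (∀ t p, VectorMeasure.Integrable Q (fun z => StrongMP.cpow2 p z * lam t z)) ∧
        (∀ᵐ t ∂(StrongMP.dMeas (StrongMP.rhoS P Z)), ∀ p, VectorMeasure.Integrable Q
          (fun z => StrongMP.cpow2 p z * StrongMP.driftDensity P Z Q lam t z)) ∧
        Continuous (fun x : StrongMP.Time T × StrongMP.Quadrant =>
          StrongMP.laplaceFun Q lam x.1 x.2) ∧
        Martingale (fun t ω => StrongMP.laplaceFun Q lam t (StrongMP.expProc Z t ω)
          - StrongMP.drift (StrongMP.rhoS P Z) (StrongMP.expProc Z)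
              (StrongMP.laplaceGen P Z Q lam) t ω) F P) ∧
    (∃ a, StrongMP.IsLaplaceOperator P Z a) ∧
    (∀ a, StrongMP.IsLaplaceOperator P Z a →
      StrongMP.SolvesStrongMP F P StrongMP.Quadrant (StrongMP.opDomain P Z) a
        (StrongMP.rhoS P Z) (StrongMP.expProc Z)) := by
  refine ⟨fun Q lam had => ⟨fun t p => ?_, ?_, had.continuous_laplaceFun hZ hρ,
    had.martingale hZ hρ⟩, StrongMP.exists_isLaplaceOperator hZ hρ,
    fun a ha => ha.solvesStrongMP hZ hρ⟩
  · exact had.integrable_cpow2_mul hZ (had.integrable_lam t) p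
  · filter_upwards [had.ae_integrable_driftDensity hρ] with t ht p
    exact had.integrable_cpow2_mul hZ ht p
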